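/- Let $\mathcal F$ be a signature (function symbols with fixed arities) and $\mathcal V$ a countably infinite set of variables. Let $\mathcal T(\mathcal F,\mathcal V)$ be the set of terms, and let $\mathcal C(\mathcal F,\mathcal V)=\mathcal T(\mathcal F\cup\{\square\},\mathcal V)$ be the set of contexts, where the hole $\square$ is a fresh constant; contexts may contain any number of holes, and terms are the contexts without holes. Let $\sqsubseteq$ be the smallest reflexive and transitive relation on contexts that is monotone (closed under function symbols) and satisfies $\square\sqsubseteq C$ for all $C$, and let $C\sqcup D$ be the supremum of $C$ and $D$ with respect to $\sqsubseteq$, if it exists. $C|_p$ is the subterm of $C$ at the position $p$, $C[D]_p$ is the result of replacing it by $D$, and $\mathcal{P}\mathrm{os}_{\mathcal F}(C)$ is the set of positions of $C$ at which the subterm is rooted by a symbol of $\mathcal F$. A TRS $\mathcal R$ over $\mathcal F$ is a set of rules $\ell\to r$ with $\ell,r\in\mathcal T(\mathcal F,\mathcal V)$, $\ell\notin\mathcal V$ and $\mathrm{Var}(r)\subseteq\mathrm{Var}(\ell)$; it is left-linear if in every left-hand side $\ell$ each variable occurs at most once. We write $s\to_{p,\ell\to r}t$ for a step with the rule $\ell\to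 r$ at the position $p$ (also on contexts), and $\to_{\mathcal R}$ for the rewrite relation on terms. A relation $\to$ is confluent if any $b,c$ with $a\to^*b$ and $a\to^*c$ for some $a$ have a $d$ with $b\to^*d$ and $c\to^*d$. It is confluent on a set $S$ if $S$ is closed under $\to$ and ${\to}\cap(S\times S)$ is confluent. Let $\mathbb L\subseteq\mathcal C(\mathcal F,\mathcal V)$. A top of a context $C$ is an $L\in\mathbb L$ with $L\sqsubseteq C$; a max-top of $C$ is a top of $C$ that is maximal with respect to $\sqsubseteq$ among the tops of $C$. The set $\mathbb L$ is a layer system if - (L1) each term in $\mathcal T(\mathcal F,\mathcal V)$ has a top different from $\square$; - (L2) for all $x\in\mathcal V$, all contexts $C$ and all positions $p$ of $C$: $C[x]_p\in\mathbb L$ if and only if $C[\square]_p\in\mathbb L$; - (L3) if $L,N\in\mathbb L$, $p\in\mathcal{P}\mathrm{os}_{\mathcal F}(L)$ and $L|_p\sqcup N$ is defined, then $L[L|_p\sqcup N]_p\in\mathbb L$. In a layer system every term $t$ has exactly one max-top $M$, and $M\ne\square$. Write $t=M[t_1,\dots,t_n]$, where the holes of $M$ are filled with $t_1,\dots,t_n$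 from left to right, and define recursively $\mathrm{rank}(t)=1+\max\{\mathrm{rank}(t_i)\mid 1\le i\le n\}$, with $\max\varnothing=0$. A TRS $\mathcal R$ is weakly layered according to $\mathbb L$ if every rule $\ell\to r\in\mathcal R$ satisfies - (W) if $M$ is a max-top of a term $s$, $p\in\mathcal{P}\mathrm{os}_{\mathcal F}(M)$ and $s\to_{p,\ell\to r}t$, then $M\to_{p,\ell\to r}L$ for some $L\in\mathbb L$. **Theorem.** Let $\mathbb L$ be a layer system and let $\mathcal R$ be a TRS that is weakly layered according to $\mathbb L$. If $\mathcal R$ is left-linear and $\to_{\mathcal R}$ is confluent on the set of terms of rank one, then $\to_{\mathcal R}$ is confluent on all terms in $\mathcal T(\mathcal F,\mathcal V)$. -/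

import Mathlib

universe u v w w'

namespace Rewriting

/-! ### Terms, positions, rewriting

A signature is given by the function symbols of a first-order language `F` (a symbol of arity `n` is
an element of `F.Functions n`; relation symbols play no role), and the terms over the signature with
variables in `V` are the elements of `F.Term V`. -/

variable {F : FirstOrder.Language.{u, v}} {V : Type w} {W : Type w'}

/-- The subterm `t|_p` of `t` at the position `p`, and `none` if `p` is not a position of `t`.
A position is the string of argument indices (counted from `0`) that leads from the root down. -/
def subtermAt : F.Term W → List ℕ → Option (F.Term W)
  | t, [] => some t
  | .var _, _ :: _ => none
  | @FirstOrder.Language.Term.func _ _ n _ ts, i :: p => if h : i < n then subtermAt (ts ⟨i, h⟩) p else none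

/-- The term `t[s]_p`: the subterm of `t` at the position `p` is replaced by `s`. -/
def replaceAt : F.Term W → List ℕ → F.Term W → F.Term W
  | _, [], s => s
  | .var x, _ :: _, _ => .var x
  | .func f ts, i :: p, s =>
      .func f (fun j => if (j : ℕ) = i then replaceAt (ts j) p s else ts j)

/-- The set `Pos(t)` of positions of `t`. -/
def positions (t : F.Term W) : Set (List ℕ) := {p | (subtermAt t p).isSome}

/-- The set `Pos_F(t)` of positions of `t` where the subterm is rooted by a function symbol. -/
def funPositions (t : F.Term W) : Set (List ℕ) :=
  {p | ∃ (n : ℕ) (f : F.Functions n) (ts : Fin n → F.Term W), subtermAt t p = some (.func f ts)}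

/-- The set `Var(t)` of variables occurring in `t`. -/
def vars (t : F.Term W) : Set W := {x | ∃ p, subtermAt t p = some (.var x)}

/-- A term is linear if every variable occurs in it at most once. -/
def IsLinear (t : F.Term W) : Prop :=
  ∀ (x : W) (p q : List ℕ),
    subtermAt t p = some (.var x) → subtermAt t q = some (.var x) → p = q

/-- A rewrite rule `lhs → rhs`: the left-hand side is not a variable and contains all variables of
the right-hand side. -/
structure Rule (F : FirstOrder.Language.{u, v}) (V : Type w) where
  lhs : F.Term V
  rhs : F.Term V
  lhs_ne_var : ∀ x : V, lhs ≠ .var x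
  vars_rhs_subset : vars rhs ⊆ vars lhs

/-- A term rewrite system over the signature `F` and the variables `V`. -/
abbrev TRS (F : FirstOrder.Language.{u, v}) (V : Type w) := Set (Rule F V)

/-- All left-hand sides are linear. -/
def LeftLinear (R : TRS F V) : Prop := ∀ ρ ∈ R, IsLinear ρ.lhs

/-- The step `s →_{p,ρ} t`, using the rule `ρ` at the position `p`. The rule has variables in `V`,
the rewritten objects are terms with variables in `W`: for `W = V` these are the terms, and for
`W = Option V` the contexts below. -/
def StepAt (ρ : Rule F V) (p : List ℕ) (s t : F.Term W) : Prop :=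
  ∃ σ : V → F.Term W,
    subtermAt s p = some (ρ.lhs.subst σ) ∧ t = replaceAt s p (ρ.rhs.subst σ)

/-- The rewrite relation of `R` on terms. -/
def Step (R : TRS F V) (s t : F.Term V) : Prop := ∃ ρ ∈ R, ∃ p, StepAt ρ p s t

/-- Confluence of a relation. -/
def Confluent {A : Type*} (r : A → A → Prop) : Prop :=
  ∀ a b c, Relation.ReflTransGen r a b → Relation.ReflTransGen r a c →
    ∃ d, Relation.ReflTransGen r b d ∧ Relation.ReflTransGen r c d

/-- Confluence of a relation on a set: the set is closed under the relation, and the restriction of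
the relation to the set is confluent. -/
def ConfluentOn {A : Type*} (r : A → A → Prop) (S : Set A) : Prop :=
  (∀ a ∈ S, ∀ b, r a b → b ∈ S) ∧ Confluent (fun a b => r a b ∧ a ∈ S ∧ b ∈ S)

/-! ### Contexts -/

/-- Contexts with an arbitrary number of holes: terms over the variables and one further symbol
`none`, the hole. The hole is not a variable: substitutions of rewrite steps act on `V` only. -/
abbrev Ctx (F : FirstOrder.Language.{u, v}) (V : Type w) := F.Term (Option V)

/-- The hole, that is, the empty context. -/
def hole : Ctx F V := .var none

/-- Terms are the contexts without holes. -/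
def toCtx (t : F.Term V) : Ctx F V := t.relabel some

/-- The order `C ⊑ D` on contexts: `D` arises from `C` by replacing holes by contexts. -/
inductive CtxLE : Ctx F V → Ctx F V → Prop
  | hole (C : Ctx F V) : CtxLE hole C
  | var (x : V) : CtxLE (.var (some x)) (.var (some x))
  | func {n : ℕ} (f : F.Functions n) (Cs Ds : Fin n → Ctx F V) (h : ∀ i, CtxLE (Cs i) (Ds i)) :
      CtxLE (.func f Cs) (.func f Ds)

theorem CtxLE.refl (C : Ctx F V) : CtxLE C C := by
  induction C with
  | var x =>
    cases x with
    | none => exact .hole _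
    | some x => exact .var x
  | func f ts ih => exact .func f ts ts ih

theorem CtxLE.trans {C D E : Ctx F V} (h₁ : CtxLE C D) (h₂ : CtxLE D E) : CtxLE C E := by
  induction h₁ generalizing E with
  | hole C => exact .hole _
  | var x => exact h₂
  | func f Cs Ds _ ih =>
    cases h₂ with
    | func _ _ Es h => exact .func f Cs Es (fun i => ih i (h i))

/-- `E` is the merge `C ⊔ D`, the supremum of `C` and `D` with respect to `⊑`. The merge is defined
if there is such an `E`. -/
def IsMerge (C D E : Ctx F V) : Prop :=
  CtxLE C E ∧ CtxLE D E ∧ ∀ E', CtxLE C E' → CtxLE D E' → CtxLE E E'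

/-! ### Layer systems -/

/-- `M` is a top of `C` according to the set `𝕃` of contexts. -/
def IsTop (𝕃 : Set (Ctx F V)) (M C : Ctx F V) : Prop := M ∈ 𝕃 ∧ CtxLE M C

/-- `M` is a max-top of `C`: it is maximal among the tops of `C`. -/
def IsMaxTop (𝕃 : Set (Ctx F V)) (M C : Ctx F V) : Prop :=
  IsTop 𝕃 M C ∧ ∀ N, IsTop 𝕃 N C → CtxLE M N → M = N

/-- Layer systems: the conditions (L1), (L2) and (L3). -/
structure IsLayerSystem (𝕃 : Set (Ctx F V)) : Prop where
  /-- Each term has a non-empty top. -/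
  L1 : ∀ t : F.Term V, ∃ M, IsTop 𝕃 M (toCtx t) ∧ M ≠ hole
  /-- `C[x]_p ∈ 𝕃` if and only if `C[□]_p ∈ 𝕃`. -/
  L2 : ∀ (x : V) (C : Ctx F V), ∀ p ∈ positions C,
    replaceAt C p (.var (some x)) ∈ 𝕃 ↔ replaceAt C p hole ∈ 𝕃
  /-- If `L, N ∈ 𝕃`, `p ∈ Pos_F(L)`, and `E = L|_p ⊔ N` is defined, then `L[E]_p ∈ 𝕃`. -/
  L3 : ∀ L ∈ 𝕃, ∀ N ∈ 𝕃, ∀ p ∈ funPositions L, ∀ D E : Ctx F V,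
    subtermAt L p = some D → IsMerge D N E → replaceAt L p E ∈ 𝕃

/-- `R` is weakly layered according to `𝕃`: every rule satisfies the condition (W). -/
def WeaklyLayered (R : TRS F V) (𝕃 : Set (Ctx F V)) : Prop :=
  ∀ ρ ∈ R, ∀ (s t : F.Term V) (M : Ctx F V) (p : List ℕ),
    IsMaxTop 𝕃 M (toCtx s) → p ∈ funPositions M → StepAt ρ p s t →
      ∃ L ∈ 𝕃, StepAt ρ p M L

/-- The terms `t₁, …, tₙ` with `t = M[t₁, …, tₙ]`, from left to right, for a context `M ⊑ t`. -/
def aliens : Ctx F V → F.Term V → List (F.Term V)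
  | .var none, t => [t]
  | .var (some _), _ => []
  | .func _ _, .var _ => []
  | @FirstOrder.Language.Term.func _ _ n _ Cs, @FirstOrder.Language.Term.func _ _ m _ ts =>
      (List.ofFn fun i : Fin n =>
        if h : (i : ℕ) < m then aliens (Cs i) (ts ⟨i, h⟩) else []).flatten

/-- The size of a term. -/
def size : F.Term V → ℕ
  | .var _ => 1
  | .func _ ts => 1 + ∑ i, size (ts i)

theorem size_le_of_mem_aliens (M : Ctx F V) (t a : F.Term V) (h : a ∈ aliens M t) :
    size a ≤ size t ∧ (M ≠ hole → size a < size t) := by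
  induction M generalizing t with
  | var x =>
    cases x with
    | none =>
      simp only [aliens, List.mem_singleton] at h
      exact ⟨by rw [h], fun h' => absurd rfl h'⟩
    | some x => simp [aliens] at h
  | func f Cs ih =>
    cases t with
    | var y => simp [aliens] at h
    | func g ts =>
      simp only [aliens, List.mem_flatten, List.mem_ofFn] at h
      obtain ⟨_, ⟨i, rfl⟩, h⟩ := h
      split_ifs at h with hi
      · have h₁ := (ih i _ h).1
        have h₂ : size (ts ⟨i, hi⟩) ≤ ∑ j, size (ts j) :=
          Finset.single_le_sum (f := fun j => size (ts j)) (fun _ _ => Nat.zero_le _)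
            (Finset.mem_univ _)
        simp only [size]
        exact ⟨by omega, fun _ => by omega⟩
      · simp at h

open Classical in
/-- The rank of a term: `rank t = 1 + max {rank t₁, …, rank tₙ}` (with `max ∅ = 0`), where
`t = M[t₁, …, tₙ]` for the max-top `M` of `t`. In a layer system every term has exactly one max-top,
which is not the hole; the value `0` is a default for other sets of contexts. -/
noncomputable def rank (𝕃 : Set (Ctx F V)) (t : F.Term V) : ℕ :=
  if h : ∃ M, IsMaxTop 𝕃 M (toCtx t) ∧ M ≠ hole then
    1 + ((aliens h.choose t).attach.map fun a => rank 𝕃 a.1).foldr max 0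
  else 0
termination_by size t
decreasing_by exact (size_le_of_mem_aliens _ _ _ a.2).2 h.choose_spec.2

end Rewriting

/-! By (L2), whether a context belongs to `𝕃` depends only on its shape, in which variables and
holes are the same kind of leaf. Hence the conditions on `𝕃` can be stated for shapes, and every
term has a greatest top, because by (L3) two tops of a term can be merged.

The rank of a term does not increase under rewriting, and confluence is shown by induction on the
rank. Cut off the aliens of rank more than `m` from a term of rank at most `m + 2`. The rest, the
base, has rank at most `m + 1`, and so have the aliens. Short steps rewrite the base, tall steps
rewrite in parallel the aliens that were cut off. The induction hypothesis closes a peak of short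
steps when it is applied to the base, and a peak of tall steps when it is applied to the aliens.
As the rules are left-linear, the base is rewritten in the same way whatever the aliens are, so a
tall and a short step commute. A tall step may lower the rank of an alien, which then becomes a
part of the base; this is the reason for the additional short steps in the diagrams. -/

namespace Rewriting

open FirstOrder.Language Relation

universe a b

variable {F : FirstOrder.Language.{u, v}} {V : Type w} {A B W : Type*}

/-! ### Terms -/

theorem subst_subst {C : Type*} (t : F.Term A) (σ : A → F.Term B) (τ : B → F.Term C) :
    (t.subst σ).subst τ = t.subst fun a => (σ a).subst τ := by
  induction t with
  | var a => rfl
  | func f ts ih => simp only [Term.subst, ih]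

theorem subst_var (t : F.Term A) : t.subst Term.var = t := by
  induction t with
  | var a => rfl
  | func f ts ih => simp only [Term.subst, ih]

theorem relabel_eq_subst (t : F.Term A) (g : A → B) :
    t.relabel g = t.subst fun a => Term.var (g a) := by
  induction t with
  | var a => rfl
  | func f ts ih => simp only [Term.subst, Term.relabel, ih]

theorem relabel_subst {C : Type*} (t : F.Term A) (g : A → B) (τ : B → F.Term C) :
    (t.relabel g).subst τ = t.subst fun a => τ (g a) := by
  rw [relabel_eq_subst, subst_subst]; rfl

theorem subst_relabel {C : Type*} (t : F.Term A) (σ : A → F.Term B) (g : B → C) :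
    (t.subst σ).relabel g = t.subst fun a => (σ a).relabel g := by
  simp only [relabel_eq_subst, subst_subst]

theorem subtermAt_func {n : ℕ} (f : F.Functions n) (ts : Fin n → F.Term A) (i : Fin n)
    (p : List ℕ) : subtermAt (.func f ts) (i :: p) = subtermAt (ts i) p := by
  simp [subtermAt]

theorem subtermAt_cons_eq_some {t s : F.Term A} {i : ℕ} {p : List ℕ}
    (h : subtermAt t (i :: p) = some s) :
    ∃ (n : ℕ) (f : F.Functions n) (ts : Fin n → F.Term A) (j : Fin n),
      t = .func f ts ∧ i = j ∧ subtermAt (ts j) p = some s := by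
  cases t with
  | var a => simp [subtermAt] at h
  | func f ts =>
    simp only [subtermAt] at h
    split_ifs at h with hi
    exact ⟨_, f, ts, ⟨i, hi⟩, rfl, rfl, h⟩

theorem replaceAt_func {n : ℕ} (f : F.Functions n) (ts : Fin n → F.Term A) (i : Fin n)
    (p : List ℕ) (s : F.Term A) :
    replaceAt (.func f ts) (i :: p) s =
      .func f (Function.update ts i (replaceAt (ts i) p s)) := by
  simp only [replaceAt]
  congr 1
  funext j
  rcases eq_or_ne j i with rfl | hji
  · simp
  · simp [hji, Fin.val_ne_of_ne hji]

theorem subtermAt_subst {t s : F.Term A} {p : List ℕ} (h : subtermAt t p = some s)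
    (τ : A → F.Term B) : subtermAt (t.subst τ) p = some (s.subst τ) := by
  induction p generalizing t with
  | nil => simp_all [subtermAt]
  | cons i p ih =>
    obtain ⟨n, f, ts, j, rfl, rfl, hj⟩ := subtermAt_cons_eq_some h
    simpa only [Term.subst, subtermAt_func] using ih hj

theorem replaceAt_subst {t u : F.Term A} {p : List ℕ} (h : subtermAt t p = some u) (s : F.Term A)
    (τ : A → F.Term B) : (replaceAt t p s).subst τ = replaceAt (t.subst τ) p (s.subst τ) := by
  induction p generalizing t with
  | nil => simp [replaceAt]
  | cons i p ih =>
    obtain ⟨n, f, ts, j, rfl, rfl, hj⟩ := subtermAt_cons_eq_some h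
    simp only [Term.subst, replaceAt_func, ← ih hj]
    congr 1
    exact Function.comp_update (fun t => t.subst τ) ts j _

theorem subtermAt_replaceAt {t u : F.Term A} {p : List ℕ} (h : subtermAt t p = some u)
    (s : F.Term A) : subtermAt (replaceAt t p s) p = some s := by
  induction p generalizing t with
  | nil => simp [subtermAt, replaceAt]
  | cons i p ih =>
    obtain ⟨n, f, ts, j, rfl, rfl, hj⟩ := subtermAt_cons_eq_some h
    rw [replaceAt_func, subtermAt_func, Function.update_self, ih hj]

theorem replaceAt_self {t s : F.Term A} {p : List ℕ} (h : subtermAt t p = some s) :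
    replaceAt t p s = t := by
  induction p generalizing t with
  | nil => simp_all [subtermAt, replaceAt]
  | cons i p ih =>
    obtain ⟨n, f, ts, j, rfl, rfl, hj⟩ := subtermAt_cons_eq_some h
    rw [replaceAt_func, ih hj, Function.update_eq_self]

theorem subtermAt_relabel (t : F.Term A) (p : List ℕ) (g : A → B) :
    subtermAt (t.relabel g) p = (subtermAt t p).map (Term.relabel g) := by
  induction t generalizing p with
  | var a => cases p <;> simp [subtermAt]
  | func f ts ih =>
    cases p with
    | nil => simp [subtermAt]
    | cons i p =>
      simp only [Term.relabel, subtermAt]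
      split_ifs
      · exact ih _ p
      · rfl

theorem mem_funPositions_relabel {t : F.Term A} {p : List ℕ} (g : A → B) :
    p ∈ funPositions (t.relabel g) ↔ p ∈ funPositions t := by
  simp only [funPositions, Set.mem_ofPred_eq, subtermAt_relabel, Option.map_eq_some_iff]
  constructor
  · rintro ⟨n, f, ts, a | ⟨f', us⟩, hu, h⟩
    · simp at h
    · exact ⟨_, f', us, hu⟩
  · rintro ⟨n, f, ts, h⟩
    exact ⟨n, f, _, _, h, rfl⟩

theorem mem_vars_var {a x : A} : x ∈ vars (.var a : F.Term A) ↔ x = a := by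
  constructor
  · rintro ⟨p, hp⟩
    cases p with
    | nil => simpa [subtermAt, eq_comm] using hp
    | cons i p => simp [subtermAt] at hp
  · rintro rfl
    exact ⟨[], rfl⟩

theorem mem_vars_func {n : ℕ} {f : F.Functions n} {ts : Fin n → F.Term A} {x : A} :
    x ∈ vars (.func f ts) ↔ ∃ i, x ∈ vars (ts i) := by
  constructor
  · rintro ⟨p, hp⟩
    cases p with
    | nil => simp [subtermAt] at hp
    | cons i p =>
      obtain ⟨_, _, _, j, ⟨⟩, -, hj⟩ := subtermAt_cons_eq_some hp
      exact ⟨j, p, hj⟩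
  · rintro ⟨i, p, hp⟩
    exact ⟨i :: p, by rw [subtermAt_func, hp]⟩

theorem vars_finite (t : F.Term A) : (vars t).Finite := by
  induction t with
  | var a => exact (Set.finite_singleton a).subset fun x hx => mem_vars_var.1 hx
  | func f ts ih =>
    exact (Set.finite_iUnion ih).subset fun x hx => Set.mem_iUnion.2 (mem_vars_func.1 hx)

theorem subst_congr {t : F.Term A} {σ τ : A → F.Term B} (h : ∀ x ∈ vars t, σ x = τ x) :
    t.subst σ = t.subst τ := by
  induction t with
  | var a => exact h a (mem_vars_var.2 rfl)
  | func f ts ih =>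
    simp only [Term.subst]
    congr 1
    funext i
    exact ih i fun x hx => h x (mem_vars_func.2 ⟨i, hx⟩)

theorem mem_vars_subst {t : F.Term A} {σ : A → F.Term B} {y : B} :
    y ∈ vars (t.subst σ) ↔ ∃ x ∈ vars t, y ∈ vars (σ x) := by
  induction t with
  | var a => simp only [Term.subst, mem_vars_var, exists_eq_left]
  | func f ts ih =>
    simp only [Term.subst, mem_vars_func, ih]
    tauto

theorem mem_vars_relabel {t : F.Term A} {g : A → B} {y : B} :
    y ∈ vars (t.relabel g) ↔ ∃ x ∈ vars t, y = g x := by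
  simp only [relabel_eq_subst, mem_vars_subst, mem_vars_var]

theorem vars_replaceAt_subset {t u s : F.Term A} {p : List ℕ} (hu : subtermAt t p = some u)
    (h : vars s ⊆ vars u) : vars (replaceAt t p s) ⊆ vars t := by
  induction p generalizing t with
  | nil => simp_all [subtermAt, replaceAt]
  | cons i p ih =>
    obtain ⟨n, f, ts, j, rfl, rfl, hj⟩ := subtermAt_cons_eq_some hu
    intro x hx
    rw [replaceAt_func] at hx
    obtain ⟨k, hk⟩ := mem_vars_func.1 hx
    rcases eq_or_ne k j with rfl | hkj
    · exact mem_vars_func.2 ⟨k, ih hj (by simpa using hk)⟩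
    · exact mem_vars_func.2 ⟨k, by simpa [hkj] using hk⟩

theorem IsLinear.arg {n : ℕ} {f : F.Functions n} {ts : Fin n → F.Term A}
    (h : IsLinear (.func f ts)) (i : Fin n) : IsLinear (ts i) := by
  intro x p q hp hq
  simpa using h x (i :: p) (i :: q) (by rw [subtermAt_func, hp]) (by rw [subtermAt_func, hq])

theorem IsLinear.eq_of_mem_vars {n : ℕ} {f : F.Functions n} {ts : Fin n → F.Term A}
    (h : IsLinear (.func f ts)) {i j : Fin n} {x : A} (hi : x ∈ vars (ts i))
    (hj : x ∈ vars (ts j)) : i = j := by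
  obtain ⟨p, hp⟩ := hi
  obtain ⟨q, hq⟩ := hj
  have hpq := h x (i :: p) (j :: q) (by rw [subtermAt_func, hp]) (by rw [subtermAt_func, hq])
  exact Fin.ext (List.cons.inj hpq).1

/-! ### Independent replacement of variables -/

/-- `Graft k s t`: the term `t` arises from `s` by replacing every occurrence of a variable `a`,
independently of the other occurrences of `a`, by some term related to `a` by `k`. -/
inductive Graft (k : A → F.Term B → Prop) : F.Term A → F.Term B → Prop
  | var {a : A} {t : F.Term B} (h : k a t) : Graft k (.var a) t
  | func {n : ℕ} (f : F.Functions n) {ss : Fin n → F.Term A} {ts : Fin n → F.Term B}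
      (h : ∀ i, Graft k (ss i) (ts i)) : Graft k (.func f ss) (.func f ts)

section Graft

variable {k : A → F.Term B → Prop}

theorem graft_var_iff {a : A} {t : F.Term B} : Graft k (.var a) t ↔ k a t :=
  ⟨fun | .var h => h, .var⟩

theorem graft_func_iff {n : ℕ} {f : F.Functions n} {ss : Fin n → F.Term A} {t : F.Term B} :
    Graft k (.func f ss) t ↔ ∃ ts, t = .func f ts ∧ ∀ i, Graft k (ss i) (ts i) :=
  ⟨fun | .func _ h => ⟨_, rfl, h⟩, fun ⟨_, ht, h⟩ => ht ▸ .func f h⟩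

theorem graft_func_func_iff {n : ℕ} {f : F.Functions n} {ss : Fin n → F.Term A}
    {ts : Fin n → F.Term B} :
    Graft k (.func f ss) (.func f ts) ↔ ∀ i, Graft k (ss i) (ts i) :=
  ⟨fun | .func _ h => h, .func f⟩

theorem Graft.mono {l : A → F.Term B → Prop} {s : F.Term A} {t : F.Term B} (h : Graft k s t)
    (hkl : ∀ a ∈ vars s, ∀ u, k a u → l a u) : Graft l s t := by
  induction h with
  | var h => exact .var (hkl _ (mem_vars_var.2 rfl) _ h)
  | func f _ ih => exact .func f fun i => ih i fun a ha => hkl a (mem_vars_func.2 ⟨i, ha⟩)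

theorem graft_subst_iff {s : F.Term W} {σ : W → F.Term A} {t : F.Term B} :
    Graft k (s.subst σ) t ↔ Graft (fun w => Graft k (σ w)) s t := by
  induction s generalizing t with
  | var w => simp only [Term.subst, graft_var_iff]
  | func f ss ih => simp only [Term.subst, graft_func_iff, ih]

theorem graft_relabel_iff {s : F.Term W} {g : W → A} {t : F.Term B} :
    Graft k (s.relabel g) t ↔ Graft (fun w => k (g w)) s t := by
  induction s generalizing t with
  | var w => simp only [Term.relabel, graft_var_iff]
  | func f ss ih => simp only [Term.relabel, graft_func_iff, ih]

theorem graft_relabel_right_iff {s : F.Term A} {t : F.Term W} {g : W → B} :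
    Graft k s (t.relabel g) ↔ Graft (fun a u => k a (u.relabel g)) s t := by
  constructor <;> intro h
  · induction t generalizing s with
    | var w => cases h with | var h => exact .var h
    | func f ts ih =>
      cases h with
      | var h => exact .var h
      | func _ h => exact .func f fun i => ih i (h i)
  · induction h with
    | var h => exact .var h
    | func f _ ih => exact .func f ih

theorem graft_self_subst_iff {t : F.Term A} {τ : A → F.Term B} :
    Graft k t (t.subst τ) ↔ ∀ x ∈ vars t, k x (τ x) := by
  induction t with
  | var a => simp only [Term.subst, graft_var_iff, mem_vars_var, forall_eq]
  | func f ts ih =>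
    simp only [Term.subst, graft_func_func_iff, ih, mem_vars_func]
    tauto

theorem Graft.subst_right {l : A → F.Term W → Prop} {s : F.Term A} {t : F.Term B}
    {τ : B → F.Term W} (h : Graft k s t) (hkl : ∀ a u, k a u → l a (u.subst τ)) :
    Graft l s (t.subst τ) := by
  induction h with
  | var h => exact .var (hkl _ _ h)
  | func f _ ih => exact .func f ih

theorem Graft.exists_labelled {A : Type a} {B : Type b} {k : A → F.Term B → Prop} {s : F.Term A}
    {t : F.Term B} (h : Graft k s t) :
    ∃ (W : Type (max a b u)) (E : F.Term W) (σ : W → A) (τ : W → F.Term B),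
      E.relabel σ = s ∧ E.subst τ = t ∧ ∀ w, k (σ w) (τ w) := by
  suffices H : ∃ E : F.Term {e : A × F.Term B // k e.1 e.2},
      E.relabel (fun e => e.1.1) = s ∧ E.subst (fun e => e.1.2) = t by
    obtain ⟨E, hs, ht⟩ := H
    exact ⟨_, E, _, _, hs, ht, fun e => e.2⟩
  induction h with
  | @var a t h => exact ⟨.var ⟨(a, t), h⟩, rfl, rfl⟩
  | func f _ ih =>
    choose Es hs ht using ih
    exact ⟨.func f Es, congrArg (Term.func f) (funext hs), congrArg (Term.func f) (funext ht)⟩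

theorem Graft.subtermAt {s u : F.Term A} {t : F.Term B} {p : List ℕ} (h : Graft k s t)
    (hu : subtermAt s p = some u) : ∃ v, subtermAt t p = some v ∧ Graft k u v := by
  induction p generalizing s t with
  | nil =>
    obtain rfl : s = u := by simpa [Rewriting.subtermAt] using hu
    exact ⟨t, by simp [Rewriting.subtermAt], h⟩
  | cons i p ih =>
    obtain ⟨n, f, ss, j, rfl, rfl, hj⟩ := subtermAt_cons_eq_some hu
    obtain ⟨ts, rfl, hts⟩ := graft_func_iff.1 h
    simpa only [subtermAt_func] using ih (hts j) hj

theorem Graft.replaceAt {s s' u : F.Term A} {t t' : F.Term B} {p : List ℕ} (h : Graft k s t)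
    (hu : Rewriting.subtermAt s p = some u) (h' : Graft k s' t') :
    Graft k (replaceAt s p s') (replaceAt t p t') := by
  induction p generalizing s t with
  | nil => simpa [Rewriting.replaceAt] using h'
  | cons i p ih =>
    obtain ⟨n, f, ss, j, rfl, rfl, hj⟩ := subtermAt_cons_eq_some hu
    obtain ⟨ts, rfl, hts⟩ := graft_func_iff.1 h
    rw [replaceAt_func, replaceAt_func]
    refine .func f fun i => ?_
    rcases eq_or_ne i j with rfl | hij
    · simpa using ih (hts i) hj
    · simpa [hij] using hts i

theorem IsLinear.graft_iff {l : F.Term A} (hl : IsLinear l) {t : F.Term B} :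
    Graft k l t ↔ ∃ τ : A → F.Term B, t = l.subst τ ∧ ∀ x ∈ vars l, k x (τ x) := by
  classical
  refine ⟨fun h => ?_, fun ⟨τ, ht, h⟩ => ht ▸ graft_self_subst_iff.2 h⟩
  induction h with
  | @var a t h => exact ⟨fun _ => t, rfl, fun x hx => mem_vars_var.1 hx ▸ h⟩
  | @func n f ls ts _ ih =>
    choose τ hτ hk using fun i => ih i (hl.arg i)
    let τ' (x : A) : F.Term B := if h : ∃ i, x ∈ vars (ls i) then τ h.choose x else .func f ts
    have hτ' (i) : ∀ x ∈ vars (ls i), τ' x = τ i x := fun x hx => by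
      have hex : ∃ i, x ∈ vars (ls i) := ⟨i, hx⟩
      simp only [τ', dif_pos hex, hl.eq_of_mem_vars hex.choose_spec hx]
    refine ⟨τ', congrArg (Term.func f) (funext fun i => ?_), fun x hx => ?_⟩
    · rw [hτ i, subst_congr (hτ' i)]
    · obtain ⟨i, hi⟩ := mem_vars_func.1 hx
      rw [hτ' i x hi]
      exact hk i x hi

end Graft

theorem graft_self_iff {k : A → F.Term A → Prop} {t : F.Term A} :
    Graft k t t ↔ ∀ x ∈ vars t, k x (.var x) := by
  simpa only [subst_var] using graft_self_subst_iff (k := k) (t := t) (τ := Term.var)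

theorem Graft.subst_eq {C : Type*} {k : A → F.Term B → Prop} {s : F.Term A} {t : F.Term B}
    {σ : A → F.Term C} {τ : B → F.Term C} (h : Graft k s t)
    (hk : ∀ a ∈ vars s, ∀ u, k a u → u.subst τ = σ a) : t.subst τ = s.subst σ := by
  induction h with
  | var h => exact hk _ (mem_vars_var.2 rfl) _ h
  | func f _ ih =>
    exact congrArg (Term.func f)
      (funext fun i => ih i fun a ha => hk a (mem_vars_func.2 ⟨i, ha⟩))

/-! ### Congruence closure and rewriting -/

section Congruence

variable {r : F.Term A → F.Term A → Prop}

theorem reflTransGen_arg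
    (hr : ∀ {n : ℕ} (f : F.Functions n) (ts : Fin n → F.Term A) (i : Fin n) (t : F.Term A),
      r (ts i) t → r (.func f ts) (.func f (Function.update ts i t)))
    {n : ℕ} (f : F.Functions n) (ts : Fin n → F.Term A) (i : Fin n) {t : F.Term A}
    (h : ReflTransGen r (ts i) t) :
    ReflTransGen r (.func f ts) (.func f (Function.update ts i t)) := by
  induction h with
  | refl => rw [Function.update_eq_self]
  | @tail u v _ hstep ih =>
    refine ih.tail ?_
    simpa using hr f (Function.update ts i u) i v (by simpa using hstep)

theorem reflTransGen_func
    (hr : ∀ {n : ℕ} (f : F.Functions n) (ts : Fin n → F.Term A) (i : Fin n) (t : F.Term A),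
      r (ts i) t → r (.func f ts) (.func f (Function.update ts i t)))
    {n : ℕ} (f : F.Functions n) {ss ts : Fin n → F.Term A}
    (h : ∀ i, ReflTransGen r (ss i) (ts i)) :
    ReflTransGen r (.func f ss) (.func f ts) := by
  suffices H : ∀ I : Finset (Fin n), ReflTransGen r (.func f ss) (.func f (I.piecewise ts ss)) by
    simpa using H Finset.univ
  intro I
  induction I using Finset.induction_on with
  | empty => rw [Finset.piecewise_empty]
  | insert i I hi ih =>
    have hi' : I.piecewise ts ss i = ss i := Finset.piecewise_eq_of_notMem I ts ss hi
    rw [Finset.piecewise_insert]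
    exact ih.trans (reflTransGen_arg hr f _ i (hi' ▸ h i))

theorem Graft.reflTransGen
    (hr : ∀ {n : ℕ} (f : F.Functions n) (ts : Fin n → F.Term A) (i : Fin n) (t : F.Term A),
      r (ts i) t → r (.func f ts) (.func f (Function.update ts i t)))
    {s : F.Term B} {t : F.Term A} {σ : B → F.Term A}
    (h : Graft (fun b u => ReflTransGen r (σ b) u) s t) : ReflTransGen r (s.subst σ) t := by
  induction h with
  | var h => exact h
  | func f _ ih => exact reflTransGen_func hr f ih

end Congruence

/-- The rewrite relation of `R` on terms with variables in an arbitrary type, so that the variables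
of a rewritten term can carry data. -/
def Rew (R : TRS F V) (s t : F.Term A) : Prop := ∃ ρ ∈ R, ∃ p, StepAt ρ p s t

/-- Rewriting in any number of steps. -/
abbrev Rews (R : TRS F V) (s t : F.Term A) : Prop := ReflTransGen (Rew R) s t

section Rew

variable {R : TRS F V}

theorem Rule.exists_lhs_eq_func (ρ : Rule F V) :
    ∃ (n : ℕ) (f : F.Functions n) (ts : Fin n → F.Term V), ρ.lhs = .func f ts := by
  rcases h : ρ.lhs with x | ⟨f, ts⟩
  · exact absurd h (ρ.lhs_ne_var x)
  · exact ⟨_, f, ts, rfl⟩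

theorem StepAt.mem_funPositions {ρ : Rule F V} {p : List ℕ} {s t : F.Term A}
    (h : StepAt ρ p s t) : p ∈ funPositions s := by
  obtain ⟨σ, hσ, -⟩ := h
  obtain ⟨n, f, ts, hf⟩ := ρ.exists_lhs_eq_func
  exact ⟨n, f, fun i => (ts i).subst σ, by rw [hσ, hf]; rfl⟩

theorem not_rew_var {a : A} {t : F.Term A} : ¬ Rew R (.var a) t := by
  rintro ⟨ρ, -, p, hstep⟩
  obtain ⟨n, f, ts, h⟩ := hstep.mem_funPositions
  cases p <;> simp [subtermAt] at h

theorem Rew.arg {n : ℕ} (f : F.Functions n) (ts : Fin n → F.Term A) (i : Fin n) (t : F.Term A)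
    (h : Rew R (ts i) t) : Rew R (.func f ts) (.func f (Function.update ts i t)) := by
  obtain ⟨ρ, hρ, p, σ, hp, rfl⟩ := h
  exact ⟨ρ, hρ, i :: p, σ, by rwa [subtermAt_func], by rw [replaceAt_func]⟩

theorem StepAt.subst {ρ : Rule F V} {p : List ℕ} {s t : F.Term A} (h : StepAt ρ p s t)
    (τ : A → F.Term B) : StepAt ρ p (s.subst τ) (t.subst τ) := by
  obtain ⟨σ, hp, rfl⟩ := h
  exact ⟨fun x => (σ x).subst τ, by rw [subtermAt_subst hp τ, subst_subst],
    by rw [replaceAt_subst hp, subst_subst]⟩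

theorem Rew.subst {s t : F.Term A} (h : Rew R s t) (τ : A → F.Term B) :
    Rew R (s.subst τ) (t.subst τ) :=
  let ⟨ρ, hρ, p, hstep⟩ := h; ⟨ρ, hρ, p, hstep.subst τ⟩

theorem Rew.vars_subset {s t : F.Term A} (h : Rew R s t) : vars t ⊆ vars s := by
  obtain ⟨ρ, -, p, σ, hp, rfl⟩ := h
  refine vars_replaceAt_subset hp fun y hy => ?_
  obtain ⟨x, hx, hy⟩ := mem_vars_subst.1 hy
  exact mem_vars_subst.2 ⟨x, ρ.vars_rhs_subset hx, hy⟩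

theorem Rews.subst {s t : F.Term A} (h : Rews R s t) (τ : A → F.Term B) :
    Rews R (s.subst τ) (t.subst τ) :=
  h.lift (fun s => s.subst τ) fun _ _ h => h.subst τ

theorem Rews.vars_subset {s t : F.Term A} (h : Rews R s t) : vars t ⊆ vars s := by
  induction h with
  | refl => exact subset_rfl
  | tail _ h ih => exact h.vars_subset.trans ih

theorem Rews.eq_of_var {a : A} {t : F.Term A} (h : Rews R (.var a) t) : t = .var a :=
  h.cases_head.elim Eq.symm fun ⟨_, hstep, _⟩ => absurd hstep not_rew_var

theorem Graft.rews_subst {s : F.Term B} {t : F.Term A} {σ : B → F.Term A}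
    (h : Graft (fun b u => Rews R (σ b) u) s t) : Rews R (s.subst σ) t :=
  h.reflTransGen Rew.arg

theorem Graft.rew (hR : LeftLinear R) {k : A → F.Term B → Prop} {s t : F.Term A} {s' : F.Term B}
    (h : Graft k s s') (hst : Rew R s t) : ∃ t', Rew R s' t' ∧ Graft k t t' := by
  obtain ⟨ρ, hρ, p, σ, hp, rfl⟩ := hst
  obtain ⟨v, hv, hgraft⟩ := h.subtermAt hp
  obtain ⟨τ, rfl, hτ⟩ := (hR ρ hρ).graft_iff.1 (graft_subst_iff.1 hgraft)
  refine ⟨_, ⟨ρ, hρ, p, τ, hv, rfl⟩, h.replaceAt hp ?_⟩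
  exact graft_subst_iff.2 (graft_self_subst_iff.2 fun x hx => hτ x (ρ.vars_rhs_subset hx))

theorem Graft.rews (hR : LeftLinear R) {k : A → F.Term B → Prop} {s t : F.Term A} {s' : F.Term B}
    (h : Graft k s s') (hst : Rews R s t) : ∃ t', Rews R s' t' ∧ Graft k t t' := by
  induction hst with
  | refl => exact ⟨s', .refl, h⟩
  | tail _ hstep ih =>
    obtain ⟨t', ht', hgraft⟩ := ih
    obtain ⟨u, hu, hgraft'⟩ := hgraft.rew hR hstep
    exact ⟨u, ht'.tail hu, hgraft'⟩

theorem Rews.of_relabel (hR : LeftLinear R) {s : F.Term A} {g : A → B} {t : F.Term B}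
    (h : Rews R (s.relabel g) t) : ∃ t', Rews R s t' ∧ t'.relabel g = t := by
  have hself : Graft (fun b u => Term.relabel g u = .var b) (s.relabel g) s :=
    graft_relabel_iff.2 (graft_self_iff.2 fun _ _ => rfl)
  obtain ⟨t', ht', hgraft⟩ := hself.rews hR h
  refine ⟨t', ht', ?_⟩
  rw [relabel_eq_subst, hgraft.subst_eq (σ := Term.var), subst_var]
  exact fun _ _ _ hu => by rwa [← relabel_eq_subst]

end Rew

/-! ### Shapes -/

/-- Shapes stand for contexts up to the choice between a variable and a hole at each leaf. -/
abbrev Shape (F : FirstOrder.Language.{u, v}) := F.Term Unit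

/-- The shape of a term, whose leaves lose their labels. -/
abbrev shape (t : F.Term A) : Shape F := t.relabel fun _ => ()

/-- The order between shapes and terms: `t` arises from `D` by replacing leaves of `D` by terms. -/
def Below (D : Shape F) (t : F.Term A) : Prop := Graft (fun _ _ => True) D t

/-- `E` is the supremum of the shapes `D` and `N`. -/
def IsShapeSup (D N E : Shape F) : Prop :=
  Below D E ∧ Below N E ∧ ∀ S : Shape F, Below D S → Below N S → Below E S

theorem below_var (t : F.Term A) : Below (.var () : Shape F) t := .var trivial

theorem Below.refl (D : Shape F) : Below D D := graft_self_iff.2 fun _ _ => trivial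

theorem Graft.below_shape {k : A → F.Term B → Prop} {s : F.Term A} {t : F.Term B}
    (h : Graft k s t) : Below (shape s) t :=
  graft_relabel_iff.2 (h.mono fun _ _ _ _ => trivial)

theorem below_shape_subst (t : F.Term A) (σ : A → F.Term B) : Below (shape t) (t.subst σ) :=
  Graft.below_shape (k := fun _ _ => True) (graft_self_subst_iff.2 fun _ _ => trivial)

theorem Below.trans_graft {D : Shape F} {k : A → F.Term B → Prop} {s : F.Term A} {t : F.Term B}
    (h : Below D s) (hst : Graft k s t) : Below D t := by
  induction hst generalizing D with
  | var _ => cases h with | var _ => exact below_var _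
  | func f _ ih =>
    cases h with
    | var _ => exact below_var _
    | func _ h => exact .func f fun i => ih i (h i)

theorem Below.trans {D E : Shape F} {t : F.Term A} (h : Below D E) (h' : Below E t) :
    Below D t := h.trans_graft h'

theorem below_relabel_iff {D : Shape F} {t : F.Term A} {g : A → B} :
    Below D (t.relabel g) ↔ Below D t :=
  graft_relabel_right_iff

theorem exists_eq_func_of_shape_eq {t : F.Term A} {n : ℕ} {f : F.Functions n}
    {Ds : Fin n → Shape F} (h : shape t = .func f Ds) :
    ∃ ts, t = .func f ts ∧ ∀ i, shape (ts i) = Ds i := by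
  cases t with
  | var a => cases h
  | func f' ts => cases h; exact ⟨ts, rfl, fun _ => rfl⟩

theorem eq_of_shape_eq_of_subst_eq {s t : F.Term A} {σ : A → F.Term B}
    (hσ : Function.Injective σ) (hshape : shape s = shape t) (h : s.subst σ = t.subst σ) :
    s = t := by
  induction s generalizing t with
  | var a =>
    cases t with
    | var b => exact congrArg Term.var (hσ h)
    | func f ts => cases hshape
  | func f ss ih =>
    obtain ⟨ts, rfl, hts⟩ := exists_eq_func_of_shape_eq hshape.symm
    simp only [Term.subst, Term.func.injEq, heq_eq_eq, true_and] at h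
    exact congrArg _ (funext fun i => ih i (hts i).symm (congrFun h i))

theorem Below.exists_decomp {D : Shape F} {t : F.Term A} (h : Below D t) :
    ∃ C : F.Term (F.Term A), shape C = D ∧ C.subst id = t := by
  obtain ⟨W, E, σ, τ, rfl, rfl, -⟩ := Graft.exists_labelled h
  exact ⟨E.relabel τ, Term.relabel_relabel _ _ _, relabel_subst _ _ _⟩

theorem exists_isShapeSup {D N : Shape F} {t : F.Term A} (hD : Below D t) (hN : Below N t) :
    ∃ E, Below E t ∧ IsShapeSup D N E := by
  induction hD generalizing N with
  | var _ => exact ⟨N, hN, below_var _, .refl N, fun _ _ h => h⟩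
  | func f hDs ih =>
    cases hN with
    | var _ => exact ⟨_, .func f hDs, Below.refl _, below_var _, fun _ h _ => h⟩
    | func _ hNs =>
      choose Es ht hDE hNE hle using fun i => ih i (hNs i)
      refine ⟨.func f Es, .func f ht, .func f hDE, .func f hNE, fun S hDS hNS => ?_⟩
      cases hDS with
      | func _ hDS => cases hNS with | func _ hNS => exact .func f fun i => hle i _ (hDS i) (hNS i)

theorem finite_setOf_below (t : F.Term A) : {D : Shape F | Below D t}.Finite := by
  induction t with
  | var a =>
    refine (Set.finite_singleton (.var ())).subset fun D hD => ?_
    cases hD with | var _ => rfl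
  | func f ts ih =>
    refine (((Set.Finite.pi' ih).image (Term.func f)).insert (.var ())).subset fun D hD => ?_
    cases hD with
    | var _ => exact .inl rfl
    | func _ hDs => exact .inr ⟨_, hDs, rfl⟩

/-- `M` is the greatest among the shapes in `𝕊` below `t`. -/
def IsGreatestTop (𝕊 : Set (Shape F)) (M : Shape F) (t : F.Term A) : Prop :=
  M ∈ 𝕊 ∧ Below M t ∧ ∀ N ∈ 𝕊, Below N t → Below N M

/-- Layer systems of shapes. By (L2) a layer system of contexts is determined by the shapes of its
members, and (L1) and (L3) turn into the following conditions on these shapes. -/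
structure IsShapeSystem (𝕊 : Set (Shape F)) : Prop where
  hole_mem : .var () ∈ 𝕊
  exists_func : ∀ {n : ℕ} (f : F.Functions n) (ts : Fin n → Shape F),
    ∃ Ds : Fin n → Shape F, .func f Ds ∈ 𝕊 ∧ ∀ i, Below (Ds i) (ts i)
  merge : ∀ L ∈ 𝕊, ∀ N ∈ 𝕊, ∀ p ∈ funPositions L, ∀ D E : Shape F,
    subtermAt L p = some D → IsShapeSup D N E → replaceAt L p E ∈ 𝕊

/-- The condition (W) for shapes. -/
def WeaklyShapeLayered (R : TRS F V) (𝕊 : Set (Shape F)) : Prop :=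
  ∀ ρ ∈ R, ∀ (s t M : Shape F) (p : List ℕ),
    IsGreatestTop 𝕊 M s → p ∈ funPositions M → StepAt ρ p s t → ∃ L ∈ 𝕊, StepAt ρ p M L

/-- A term `C` whose variables are themselves terms stands for the decomposition of `C.subst id`
into the shape of `C` and the terms in its holes. It is saturated if each of its non-variable
subterms is above all tops of the corresponding part of `C.subst id`. -/
def Saturated (𝕊 : Set (Shape F)) (C : F.Term (F.Term A)) : Prop :=
  ∀ (p : List ℕ) (n : ℕ) (f : F.Functions n) (Cs : Fin n → F.Term (F.Term A)),
    subtermAt C p = some (.func f Cs) →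
      ∀ N ∈ 𝕊, Below N ((Term.func f Cs).subst id) → Below N (.func f Cs)

section ShapeSystem

variable {𝕊 : Set (Shape F)}

theorem isGreatestTop_relabel_iff {M : Shape F} {t : F.Term A} {g : A → B} :
    IsGreatestTop 𝕊 M (t.relabel g) ↔ IsGreatestTop 𝕊 M t := by
  simp only [IsGreatestTop, below_relabel_iff]

theorem IsShapeSystem.exists_sup_mem (h𝕊 : IsShapeSystem 𝕊) {M N : Shape F} {t : F.Term A}
    (hM : M ∈ 𝕊) (hMt : Below M t) (hN : N ∈ 𝕊) (hNt : Below N t) :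
    ∃ E ∈ 𝕊, Below E t ∧ Below M E ∧ Below N E := by
  cases M with
  | var _ => exact ⟨N, hN, hNt, below_var N, .refl N⟩
  | func f Ms =>
    obtain ⟨E, hEt, hE⟩ := exists_isShapeSup hMt hNt
    have hE𝕊 := h𝕊.merge _ hM N hN [] ⟨_, f, Ms, by simp [subtermAt]⟩ _ E
      (by simp [subtermAt]) hE
    exact ⟨E, by simpa [replaceAt] using hE𝕊, hEt, hE.1, hE.2.1⟩

theorem IsShapeSystem.exists_isGreatestTop (h𝕊 : IsShapeSystem 𝕊) (t : F.Term A) :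
    ∃ M, IsGreatestTop 𝕊 M t := by
  let tops : Set (Shape F) := {N | N ∈ 𝕊 ∧ Below N t}
  have : Finite tops := ((finite_setOf_below t).subset fun _ h => h.2).to_subtype
  have : Nonempty tops := ⟨⟨_, h𝕊.hole_mem, below_var t⟩⟩
  have : IsTrans (Shape F) Below := ⟨fun _ _ _ => Below.trans⟩
  have hdir : Directed Below (Subtype.val : tops → Shape F) := fun M N =>
    let ⟨E, hE, hEt, hME, hNE⟩ := h𝕊.exists_sup_mem M.2.1 M.2.2 N.2.1 N.2.2
    ⟨⟨E, hE, hEt⟩, hME, hNE⟩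
  obtain ⟨M, hM⟩ := hdir.finite_le id
  exact ⟨M, M.2.1, M.2.2, fun N hN hNt => hM ⟨N, hN, hNt⟩⟩

theorem IsShapeSystem.exists_decomp (h𝕊 : IsShapeSystem 𝕊) (t : F.Term A) :
    ∃ C : F.Term (F.Term A), C.subst id = t ∧ IsGreatestTop 𝕊 (shape C) t := by
  obtain ⟨M, hM⟩ := h𝕊.exists_isGreatestTop t
  obtain ⟨C, rfl, hC⟩ := hM.2.1.exists_decomp
  exact ⟨C, hC, hM⟩

/-- The decomposition of a term into its greatest top and the aliens below it, which label the
holes of the top. -/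
noncomputable def IsShapeSystem.decomp (h𝕊 : IsShapeSystem 𝕊) (t : F.Term A) :
    F.Term (F.Term A) := (h𝕊.exists_decomp t).choose

theorem IsShapeSystem.decomp_subst (h𝕊 : IsShapeSystem 𝕊) (t : F.Term A) :
    (h𝕊.decomp t).subst id = t := (h𝕊.exists_decomp t).choose_spec.1

theorem IsShapeSystem.isGreatestTop_decomp (h𝕊 : IsShapeSystem 𝕊) (t : F.Term A) :
    IsGreatestTop 𝕊 (shape (h𝕊.decomp t)) t := (h𝕊.exists_decomp t).choose_spec.2

theorem Saturated.below_of_func {n : ℕ} {f : F.Functions n} {Cs : Fin n → F.Term (F.Term A)}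
    (h : Saturated 𝕊 (.func f Cs)) {N : Shape F} (hN : N ∈ 𝕊)
    (hNt : Below N ((Term.func f Cs).subst id)) : Below N (.func f Cs) :=
  h [] n f Cs (by simp [subtermAt]) N hN hNt

theorem Saturated.arg {n : ℕ} {f : F.Functions n} {Cs : Fin n → F.Term (F.Term A)}
    (h : Saturated 𝕊 (.func f Cs)) (i : Fin n) : Saturated 𝕊 (Cs i) :=
  fun p n g Ds hp => h (i :: p) n g Ds (by rwa [subtermAt_func])

/-- A top of an inner part of the term could otherwise be merged into the greatest top. -/
theorem IsShapeSystem.saturated_decomp (h𝕊 : IsShapeSystem 𝕊) (t : F.Term A) :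
    Saturated 𝕊 (h𝕊.decomp t) := by
  obtain ⟨hM, hMt, hmax⟩ := h𝕊.isGreatestTop_decomp t
  generalize hC : h𝕊.decomp t = C at hM hMt hmax ⊢
  obtain rfl : C.subst id = t := hC ▸ h𝕊.decomp_subst t
  intro p n f Cs hp N hN hNt
  obtain ⟨E, hEt, hE⟩ := exists_isShapeSup (below_shape_subst (Term.func f Cs) id) hNt
  have hshape : subtermAt (shape C) p = some (shape (.func f Cs)) := by
    rw [subtermAt_relabel, hp, Option.map_some]
  have hmerge : replaceAt (shape C) p E ∈ 𝕊 :=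
    h𝕊.merge _ hM N hN p ⟨n, f, _, hshape⟩ _ E hshape hE
  have hbelow : Below (replaceAt (shape C) p E) (C.subst id) := by
    rw [← replaceAt_self (subtermAt_subst hp id)]
    exact hMt.replaceAt hshape hEt
  obtain ⟨D, hD, hED⟩ := (hmax _ hmerge hbelow).subtermAt (subtermAt_replaceAt hshape E)
  obtain rfl : shape (.func f Cs) = D := Option.some.inj (hshape.symm.trans hD)
  exact below_relabel_iff.1 (hE.2.1.trans hED)

end ShapeSystem

/-! ### Layered terms and the rank -/

/-- The term consists of a layer with terms satisfying `P` in its holes. -/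
def Layered (𝕊 : Set (Shape F)) (P : F.Term A → Prop) (t : F.Term A) : Prop :=
  ∃ L ∈ 𝕊, Graft (fun _ => P) L t

/-- The property `P` is inherited by the terms in the holes of saturated decompositions. -/
def PassesToAliens (𝕊 : Set (Shape F)) (P : F.Term A → Prop) : Prop :=
  ∀ C : F.Term (F.Term A), Saturated 𝕊 C → P (C.subst id) → ∀ u ∈ vars C, P u

/-- The rank of the term is at most `n`, where variables have rank `0`. -/
def RankLE (𝕊 : Set (Shape F)) : ℕ → F.Term A → Prop
  | 0, t => ∃ a, t = .var a
  | n + 1, t => Layered 𝕊 (RankLE 𝕊 n) t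

section Layered

variable {𝕊 : Set (Shape F)} {P : F.Term A → Prop}

theorem layered_of_shape_mem {C : F.Term W} {k : W → F.Term A → Prop} {t : F.Term A}
    (hC : shape C ∈ 𝕊) (h : Graft k C t) (hP : ∀ w ∈ vars C, ∀ u, k w u → P u) :
    Layered 𝕊 P t :=
  ⟨_, hC, graft_relabel_iff.2 (h.mono hP)⟩

theorem layered_subst {C : F.Term W} {σ : W → F.Term A} (hC : shape C ∈ 𝕊)
    (h : ∀ w ∈ vars C, P (σ w)) : Layered 𝕊 P (C.subst σ) :=
  layered_of_shape_mem hC (graft_self_subst_iff.2 h) fun _ _ _ => id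

theorem Layered.mono {Q : F.Term A → Prop} {t : F.Term A} (h : Layered 𝕊 P t)
    (hPQ : ∀ u, P u → Q u) : Layered 𝕊 Q t :=
  let ⟨L, hL, hLt⟩ := h; ⟨L, hL, hLt.mono fun _ _ => hPQ⟩

theorem layered_relabel_iff {Q : F.Term B → Prop} {t : F.Term A} {g : A → B} :
    Layered 𝕊 Q (t.relabel g) ↔ Layered 𝕊 (fun u => Q (u.relabel g)) t := by
  simp only [Layered, graft_relabel_right_iff]

theorem Saturated.forall_of_graft (hP : PassesToAliens 𝕊 P) {L : Shape F}
    {C : F.Term (F.Term A)} (hC : Saturated 𝕊 C) (hL : Below L C)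
    (h : Graft (fun _ => P) L (C.subst id)) : ∀ u ∈ vars C, P u := by
  induction hL with
  | var _ => exact hP _ hC (graft_var_iff.1 h)
  | func f _ ih =>
    intro u hu
    obtain ⟨i, hi⟩ := mem_vars_func.1 hu
    exact ih i (hC.arg i) (graft_func_func_iff.1 h i) u hi

theorem Layered.forall_of_saturated_func (hP : PassesToAliens 𝕊 P) {n : ℕ} {f : F.Functions n}
    {Cs : Fin n → F.Term (F.Term A)} (h : Layered 𝕊 P ((Term.func f Cs).subst id))
    (hC : Saturated 𝕊 (.func f Cs)) : ∀ u ∈ vars (.func f Cs), P u := by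
  obtain ⟨L, hL, hgraft⟩ := h
  exact hC.forall_of_graft hP
    (hC.below_of_func hL (hgraft.mono fun _ _ _ _ => trivial)) hgraft

theorem Layered.forall_vars_decomp (h𝕊 : IsShapeSystem 𝕊) (hP : PassesToAliens 𝕊 P)
    {t : F.Term A} (h : Layered 𝕊 P t) : ∀ u ∈ vars (h𝕊.decomp t), P u := by
  obtain ⟨L, hL, hgraft⟩ := h
  have hbelow : Below L (shape (h𝕊.decomp t)) :=
    (h𝕊.isGreatestTop_decomp t).2.2 L hL (hgraft.mono fun _ _ _ _ => trivial)
  refine (h𝕊.saturated_decomp t).forall_of_graft hP (below_relabel_iff.1 hbelow) ?_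
  rwa [h𝕊.decomp_subst]

theorem IsShapeSystem.layered (h𝕊 : IsShapeSystem 𝕊) {t : F.Term A} (h : P t) :
    Layered 𝕊 P t := ⟨_, h𝕊.hole_mem, .var h⟩

theorem PassesToAliens.layered (h𝕊 : IsShapeSystem 𝕊) (hP : PassesToAliens 𝕊 P) :
    PassesToAliens 𝕊 (Layered 𝕊 P) := by
  intro C hC h u hu
  cases C with
  | var w => exact mem_vars_var.1 hu ▸ h
  | func f Cs => exact h𝕊.layered (h.forall_of_saturated_func hP hC u hu)

theorem RankLE.succ (h𝕊 : IsShapeSystem 𝕊) {n : ℕ} {t : F.Term A} (h : RankLE 𝕊 n t) :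
    RankLE 𝕊 (n + 1) t := h𝕊.layered h

theorem RankLE.mono (h𝕊 : IsShapeSystem 𝕊) {m n : ℕ} (hmn : m ≤ n) {t : F.Term A}
    (h : RankLE 𝕊 m t) : RankLE 𝕊 n t :=
  Nat.le_induction h (fun _ _ => RankLE.succ h𝕊) n hmn

theorem rankLE_var (h𝕊 : IsShapeSystem 𝕊) (n : ℕ) (a : A) : RankLE 𝕊 n (.var a : F.Term A) :=
  RankLE.mono h𝕊 (Nat.zero_le n) ⟨a, rfl⟩

theorem rankLE_relabel_iff {n : ℕ} {t : F.Term A} {g : A → B} :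
    RankLE 𝕊 n (t.relabel g) ↔ RankLE 𝕊 n t := by
  induction n generalizing t with
  | zero => cases t <;> simp [RankLE]
  | succ n ih => simp only [RankLE, layered_relabel_iff, ih]

theorem passesToAliens_rankLE (h𝕊 : IsShapeSystem 𝕊) (n : ℕ) :
    PassesToAliens 𝕊 (RankLE 𝕊 n : F.Term A → Prop) := by
  induction n with
  | zero =>
    rintro (u | ⟨f, Cs⟩) - ⟨a, ha⟩ v hv
    · exact mem_vars_var.1 hv ▸ ⟨a, ha⟩
    · cases ha
  | succ n ih => exact ih.layered h𝕊

theorem exists_rankLE (h𝕊 : IsShapeSystem 𝕊) (t : F.Term A) : ∃ n, RankLE 𝕊 n t := by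
  suffices h : ∃ n, ∀ D : Shape F, Below D t → Graft (fun _ => RankLE 𝕊 n) D t by
    obtain ⟨n, h⟩ := h
    exact ⟨n, (graft_var_iff (k := fun _ => RankLE 𝕊 n)).1 (h (.var ()) (below_var t))⟩
  induction t with
  | var a => exact ⟨0, fun D hD => by cases hD with | var _ => exact .var ⟨a, rfl⟩⟩
  | func f ts ih =>
    choose n hn using ih
    have hargs : ∀ i, ∀ D : Shape F, Below D (ts i) →
        Graft (fun _ => RankLE 𝕊 (∑ i, n i)) D (ts i) := fun i D hD =>
      (hn i D hD).mono fun _ _ _ => RankLE.mono h𝕊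
        (Finset.single_le_sum (fun _ _ => Nat.zero_le _) (Finset.mem_univ i))
    obtain ⟨Ds, hDs, hD⟩ := h𝕊.exists_func f fun i => shape (ts i)
    refine ⟨(∑ i, n i) + 1, fun D hDt => ?_⟩
    cases hDt with
    | var _ => exact .var ⟨_, hDs, .func f fun i => hargs i _ (below_relabel_iff.1 (hD i))⟩
    | func _ h => exact .func f fun i => (hargs i _ (h i)).mono fun _ _ _ => RankLE.succ h𝕊

end Layered

/-! ### Rewriting layered terms -/

theorem StepAt.exists_graft_of_notMem {ρ : Rule F V} {p : List ℕ} {C : F.Term W}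
    {σ : W → F.Term A} {t : F.Term A} (h : StepAt ρ p (C.subst σ) t) (hp : p ∉ funPositions C) :
    ∃ w ∈ vars C, ∃ v, (∃ q, StepAt ρ q (σ w) v) ∧
      Graft (fun a b => b = σ a ∨ a = w ∧ b = v) C t := by
  induction C generalizing p t with
  | var w => exact ⟨w, mem_vars_var.2 rfl, t, ⟨p, h⟩, .var (.inr ⟨rfl, rfl⟩)⟩
  | func f Cs ih =>
    obtain ⟨τ, hτ, rfl⟩ := h
    rcases p with - | ⟨i, p⟩
    · exact absurd ⟨_, f, Cs, by simp [subtermAt]⟩ hp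
    obtain ⟨_, _, _, j, hC, rfl, -⟩ := subtermAt_cons_eq_some hτ
    cases hC
    rw [Term.subst, subtermAt_func] at hτ
    have hp' : p ∉ funPositions (Cs j) := by
      simpa only [funPositions, Set.mem_ofPred_eq, subtermAt_func] using hp
    obtain ⟨w, hw, v, hstep, hgraft⟩ := ih j ⟨τ, hτ, rfl⟩ hp'
    refine ⟨w, mem_vars_func.2 ⟨j, hw⟩, v, hstep, ?_⟩
    rw [Term.subst, replaceAt_func, graft_func_func_iff]
    intro i
    rcases eq_or_ne i j with rfl | hij
    · rwa [Function.update_self]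
    · rw [Function.update_of_ne hij]
      exact graft_self_subst_iff.2 fun _ _ => .inl rfl

theorem exists_eq_subst_of_shape_eq {l : F.Term V} {X : F.Term (F.Term A)} {σ : V → Shape F}
    {τ : V → F.Term A} (hshape : shape X = l.subst σ) (h : X.subst id = l.subst τ) :
    ∃ σ', X = l.subst σ' ∧ ∀ x ∈ vars l, shape (σ' x) = σ x ∧ (σ' x).subst id = τ x := by
  have hbelow : ∀ x ∈ vars l, Below (σ x) (τ x) := by
    have := below_shape_subst X id
    rwa [hshape, h, Below, graft_subst_iff, graft_self_subst_iff] at this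
  have hdecomp : ∀ x, ∃ Y, x ∈ vars l → shape Y = σ x ∧ Y.subst id = τ x := fun x => by
    by_cases hx : x ∈ vars l
    · obtain ⟨Y, hY⟩ := (hbelow x hx).exists_decomp
      exact ⟨Y, fun _ => hY⟩
    · exact ⟨.var (τ x), fun hx' => absurd hx' hx⟩
  choose σ' hσ' using hdecomp
  refine ⟨σ', eq_of_shape_eq_of_subst_eq Function.injective_id ?_ ?_, hσ'⟩
  · rw [hshape, shape, subst_relabel]
    exact subst_congr fun x hx => (hσ' x hx).1.symm
  · rw [h, subst_subst]
    exact subst_congr fun x hx => (hσ' x hx).2.symm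

theorem StepAt.exists_lift {ρ : Rule F V} {p : List ℕ} {C : F.Term (F.Term A)} {L : Shape F}
    {t : F.Term A} (hL : StepAt ρ p (shape C) L) (ht : StepAt ρ p (C.subst id) t) :
    ∃ D, StepAt ρ p C D ∧ shape D = L ∧ D.subst id = t := by
  obtain ⟨σ, hσ, rfl⟩ := hL
  obtain ⟨τ, hτ, rfl⟩ := ht
  rw [subtermAt_relabel, Option.map_eq_some_iff] at hσ
  obtain ⟨X, hX, hshape⟩ := hσ
  have hsubst : X.subst id = ρ.lhs.subst τ :=
    Option.some.inj ((subtermAt_subst hX id).symm.trans hτ)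
  obtain ⟨σ', rfl, hσ'⟩ := exists_eq_subst_of_shape_eq hshape hsubst
  refine ⟨_, ⟨σ', hX, rfl⟩, ?_, ?_⟩
  · rw [shape, relabel_eq_subst, replaceAt_subst hX, ← relabel_eq_subst, ← relabel_eq_subst,
      subst_relabel]
    exact congrArg _ (subst_congr fun x hx => (hσ' x (ρ.vars_rhs_subset hx)).1)
  · rw [replaceAt_subst hX, subst_subst]
    exact congrArg _ (subst_congr fun x hx => (hσ' x (ρ.vars_rhs_subset hx)).2)

/-- Confluence of the terms with variables in `A` whose rank is at most `n`. -/
def ConfluentUpTo (R : TRS F V) (𝕊 : Set (Shape F)) (n : ℕ) (A : Type*) : Prop :=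
  ∀ s t₁ t₂ : F.Term A, RankLE 𝕊 n s → Rews R s t₁ → Rews R s t₂ →
    ∃ t, Rews R t₁ t ∧ Rews R t₂ t

section RewLayered

variable {R : TRS F V} {𝕊 : Set (Shape F)}

theorem Rew.decomp_cases (h𝕊 : IsShapeSystem 𝕊) (hW : WeaklyShapeLayered R 𝕊) {s t : F.Term A}
    (h : Rew R s t) :
    (∃ D, Rew R (h𝕊.decomp s) D ∧ shape D ∈ 𝕊 ∧ D.subst id = t) ∨
      ∃ u ∈ vars (h𝕊.decomp s), ∃ v, Rew R u v ∧
        Graft (fun a b => b = a ∨ a = u ∧ b = v) (h𝕊.decomp s) t := by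
  obtain ⟨ρ, hρ, p, hstep⟩ := h
  have hdecomp : StepAt ρ p ((h𝕊.decomp s).subst id) t := by rwa [h𝕊.decomp_subst]
  by_cases hp : p ∈ funPositions (h𝕊.decomp s)
  · have hshape : StepAt ρ p (shape s) (shape t) := by
      simpa only [shape, relabel_eq_subst] using hstep.subst _
    obtain ⟨L, hL, hstep'⟩ := hW ρ hρ _ _ _ p
      (isGreatestTop_relabel_iff.2 (h𝕊.isGreatestTop_decomp s))
      ((mem_funPositions_relabel _).2 hp) hshape
    obtain ⟨D, hD, rfl, rfl⟩ := hstep'.exists_lift hdecomp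
    exact .inl ⟨D, ⟨ρ, hρ, p, hD⟩, hL, rfl⟩
  · obtain ⟨u, hu, v, ⟨q, hq⟩, hgraft⟩ := hdecomp.exists_graft_of_notMem hp
    exact .inr ⟨u, hu, v, ⟨ρ, hρ, q, hq⟩, hgraft⟩

theorem Layered.rew (h𝕊 : IsShapeSystem 𝕊) (hW : WeaklyShapeLayered R 𝕊)
    {P : F.Term A → Prop} (hP : PassesToAliens 𝕊 P) (hrew : ∀ {u v}, P u → Rew R u v → P v)
    {s t : F.Term A} (hs : Layered 𝕊 P s) (h : Rew R s t) : Layered 𝕊 P t := by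
  have hP' := hs.forall_vars_decomp h𝕊 hP
  rcases h.decomp_cases h𝕊 hW with ⟨D, hD, hD𝕊, rfl⟩ | ⟨u, hu, v, huv, hgraft⟩
  · exact layered_subst hD𝕊 fun w hw => hP' w (hD.vars_subset hw)
  · refine layered_of_shape_mem (h𝕊.isGreatestTop_decomp s).1 hgraft ?_
    rintro w hw b (rfl | ⟨-, rfl⟩)
    · exact hP' _ hw
    · exact hrew (hP' u hu) huv

theorem RankLE.rew (h𝕊 : IsShapeSystem 𝕊) (hW : WeaklyShapeLayered R 𝕊) {n : ℕ} {s t : F.Term A}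
    (hs : RankLE 𝕊 n s) (h : Rew R s t) : RankLE 𝕊 n t := by
  induction n generalizing s t with
  | zero => obtain ⟨a, rfl⟩ := hs; exact absurd h not_rew_var
  | succ n ih => exact Layered.rew h𝕊 hW (passesToAliens_rankLE h𝕊 n) ih hs h

theorem RankLE.rews (h𝕊 : IsShapeSystem 𝕊) (hW : WeaklyShapeLayered R 𝕊) {n : ℕ}
    {s t : F.Term A} (hs : RankLE 𝕊 n s) (h : Rews R s t) : RankLE 𝕊 n t := by
  induction h with
  | refl => exact hs
  | tail _ hstep ih => exact ih.rew h𝕊 hW hstep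

/-- A term has only finitely many variables, which can be renamed apart in any infinite type. -/
theorem ConfluentUpTo.transfer [Infinite B] [Nonempty A] {n : ℕ} (h : ConfluentUpTo R 𝕊 n B) :
    ConfluentUpTo R 𝕊 n A := by
  intro s t₁ t₂ hs h₁ h₂
  obtain ⟨g, -, hg⟩ := (vars_finite s).exists_injOn_of_encard_le (t := (Set.univ : Set B))
    (by simp)
  have hrelabel : ∀ {t}, Rews R s t → Rews R (s.relabel g) (t.relabel g) := fun ht => by
    simpa only [relabel_eq_subst] using ht.subst fun a => .var (g a)
  have hback : ∀ {t}, Rews R s t → (t.relabel g).relabel (Function.invFunOn g (vars s)) = t := by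
    intro t ht
    rw [Term.relabel_relabel, relabel_eq_subst]
    exact (subst_congr fun x hx => congrArg _ (hg.leftInvOn_invFunOn (ht.vars_subset hx))).trans
      (subst_var t)
  obtain ⟨t, ht₁, ht₂⟩ := h _ _ _ (rankLE_relabel_iff.2 hs) (hrelabel h₁) (hrelabel h₂)
  refine ⟨t.relabel (Function.invFunOn g (vars s)), ?_, ?_⟩
  · simpa only [← relabel_eq_subst, hback h₁] using
      ht₁.subst fun b => .var (Function.invFunOn g (vars s) b)
  · simpa only [← relabel_eq_subst, hback h₂] using
      ht₂.subst fun b => .var (Function.invFunOn g (vars s) b)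

end RewLayered

/-! ### Bases -/

open Classical in
/-- The term `u` as a term with holes for terms: `u` with variables in its holes if its rank is at
most `m`, and a single hole for `u` otherwise. -/
noncomputable def mark (𝕊 : Set (Shape F)) (m : ℕ) (u : F.Term A) : F.Term (F.Term A) :=
  if RankLE 𝕊 m u then u.relabel .var else .var u

/-- The base of a term: the aliens of rank larger than `m` are cut off. The base is a term whose
variables are the aliens that were cut off and the variables `.var a` of the original term. -/
noncomputable def IsShapeSystem.base {𝕊 : Set (Shape F)} (h𝕊 : IsShapeSystem 𝕊) (m : ℕ)
    (t : F.Term A) : F.Term (F.Term A) := (h𝕊.decomp t).subst (mark 𝕊 m)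

/-- The terms in the holes of a base: holes for terms of rank at most `m + 1`, and terms of rank at
most `m`. The labels of the holes stand for the terms given by `τ`, and the labels of the terms of
rank at most `m` stand for variables. -/
def IsBasePart (𝕊 : Set (Shape F)) (m : ℕ) (τ : W → F.Term A) (D : F.Term W) : Prop :=
  (∃ w, D = .var w ∧ RankLE 𝕊 (m + 1) (τ w)) ∨ RankLE 𝕊 m D ∧ ∀ w ∈ vars D, ∃ x, τ w = .var x

/-- The term `C` with labels in `W` can play the role of a base of `C.subst τ`: it is a layer with
parts of bases in its holes. In contrast to `IsShapeSystem.base` the layer need not be greatest, so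
that the notion is closed under rewriting of `C`. -/
def IsBase (𝕊 : Set (Shape F)) (m : ℕ) (τ : W → F.Term A) (C : F.Term W) : Prop :=
  Layered 𝕊 (IsBasePart 𝕊 m τ) C

section Base

variable {R : TRS F V} {𝕊 : Set (Shape F)} {m : ℕ}

theorem mark_subst (u : F.Term A) : (mark 𝕊 m u).subst id = u := by
  rw [mark]
  split_ifs
  · rw [relabel_subst]; exact subst_var u
  · rfl

theorem IsShapeSystem.base_subst (h𝕊 : IsShapeSystem 𝕊) (m : ℕ) (t : F.Term A) :
    (h𝕊.base m t).subst id = t := by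
  simp only [IsShapeSystem.base, subst_subst, mark_subst]
  exact h𝕊.decomp_subst t

theorem subst_mark_of_forall {C : F.Term (F.Term A)} (h : ∀ u ∈ vars C, RankLE 𝕊 m u) :
    C.subst (mark 𝕊 m) = (C.subst id).relabel .var := by
  rw [subst_relabel]
  exact subst_congr fun u hu => if_pos (h u hu)

theorem RankLE.subst_of_forall_vars {D : F.Term W} {τ : W → F.Term A} (hD : RankLE 𝕊 m D)
    (hτ : ∀ w ∈ vars D, ∃ x, τ w = .var x) : RankLE 𝕊 m (D.subst τ) := by
  have hshape : (D.subst τ).relabel (fun _ => ()) = D.relabel fun _ => () := by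
    rw [subst_relabel, relabel_eq_subst]
    refine subst_congr fun w hw => ?_
    obtain ⟨x, hx⟩ := hτ w hw
    rw [hx, Term.relabel]
  rw [← rankLE_relabel_iff (g := fun _ => ())] at hD ⊢
  rwa [hshape]

theorem isBase_base (h𝕊 : IsShapeSystem 𝕊) {t : F.Term A} (ht : RankLE 𝕊 (m + 2) t) :
    IsBase 𝕊 m id (h𝕊.base m t) := by
  refine layered_subst (h𝕊.isGreatestTop_decomp t).1 fun u hu => ?_
  rw [mark]
  split_ifs with hm
  · refine .inr ⟨rankLE_relabel_iff.2 hm, fun w hw => ?_⟩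
    obtain ⟨x, -, hx⟩ := mem_vars_relabel.1 hw
    exact ⟨x, hx⟩
  · exact .inl ⟨u, rfl, ht.forall_vars_decomp h𝕊 (passesToAliens_rankLE h𝕊 (m + 1)) u hu⟩

theorem IsBase.of_relabel {g : B → W} {τ : W → F.Term A} {C : F.Term B}
    (h : IsBase 𝕊 m τ (C.relabel g)) : IsBase 𝕊 m (fun b => τ (g b)) C := by
  refine (layered_relabel_iff.1 h).mono fun D hD => ?_
  rcases hD with ⟨w, hw, hrank⟩ | ⟨hrank, hvars⟩
  · cases D with
    | var b => cases hw; exact .inl ⟨b, rfl, hrank⟩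
    | func f Ds => cases hw
  · exact .inr ⟨rankLE_relabel_iff.1 hrank, fun b hb => hvars _ (mem_vars_relabel.2 ⟨b, hb, rfl⟩)⟩

theorem IsBase.rankLE (h𝕊 : IsShapeSystem 𝕊) {τ : W → F.Term A} {C : F.Term W}
    (h : IsBase 𝕊 m τ C) : RankLE 𝕊 (m + 1) C := by
  refine Layered.mono h ?_
  rintro D (⟨w, rfl, -⟩ | ⟨hD, -⟩)
  exacts [rankLE_var h𝕊 m w, hD]

theorem IsBase.rankLE_subst (h𝕊 : IsShapeSystem 𝕊) {τ : W → F.Term A} {C : F.Term W}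
    (h : IsBase 𝕊 m τ C) : RankLE 𝕊 (m + 2) (C.subst τ) := by
  obtain ⟨L, hL, hgraft⟩ := h
  refine ⟨L, hL, hgraft.subst_right ?_⟩
  rintro - D (⟨w, rfl, hw⟩ | ⟨hD, hvars⟩)
  exacts [hw, (hD.subst_of_forall_vars hvars).succ h𝕊]

theorem passesToAliens_isBasePart (h𝕊 : IsShapeSystem 𝕊) (m : ℕ) (τ : W → F.Term A) :
    PassesToAliens 𝕊 (IsBasePart 𝕊 m τ) := by
  rintro C hC (⟨w, hw, hrank⟩ | ⟨hrank, hvars⟩) u hu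
  · cases C with
    | var u' => obtain rfl := mem_vars_var.1 hu; exact .inl ⟨w, hw, hrank⟩
    | func f Cs => cases hw
  · exact .inr ⟨passesToAliens_rankLE h𝕊 m C hC hrank u hu,
      fun w hw => hvars w (mem_vars_subst.2 ⟨u, hu, hw⟩)⟩

theorem IsBasePart.rew (h𝕊 : IsShapeSystem 𝕊) (hW : WeaklyShapeLayered R 𝕊) {τ : W → F.Term A}
    {C D : F.Term W} (h : IsBasePart 𝕊 m τ C) (hCD : Rew R C D) : IsBasePart 𝕊 m τ D := by
  rcases h with ⟨w, rfl, -⟩ | ⟨hrank, hvars⟩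
  · exact absurd hCD not_rew_var
  · exact .inr ⟨hrank.rew h𝕊 hW hCD, fun w hw => hvars w (hCD.vars_subset hw)⟩

theorem IsBase.rews (h𝕊 : IsShapeSystem 𝕊) (hW : WeaklyShapeLayered R 𝕊) {τ : W → F.Term A}
    {C D : F.Term W} (h : IsBase 𝕊 m τ C) (hCD : Rews R C D) : IsBase 𝕊 m τ D := by
  induction hCD with
  | refl => exact h
  | tail _ hstep ih =>
    exact Layered.rew h𝕊 hW (passesToAliens_isBasePart h𝕊 m τ) (IsBasePart.rew h𝕊 hW) ih hstep

theorem IsBase.of_rews (h𝕊 : IsShapeSystem 𝕊) (hW : WeaklyShapeLayered R 𝕊) {τ τ' : W → F.Term A}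
    {C : F.Term W} (h : IsBase 𝕊 m τ C) (hτ : ∀ w, Rews R (τ w) (τ' w)) : IsBase 𝕊 m τ' C := by
  refine Layered.mono h ?_
  rintro D (⟨w, rfl, hw⟩ | ⟨hD, hvars⟩)
  · exact .inl ⟨w, rfl, hw.rews h𝕊 hW (hτ w)⟩
  · refine .inr ⟨hD, fun w hw => ?_⟩
    obtain ⟨x, hx⟩ := hvars w hw
    exact ⟨x, (hx ▸ hτ w).eq_of_var⟩

theorem Saturated.graft_subst_mark (h𝕊 : IsShapeSystem 𝕊) {D : F.Term W} {τ : W → F.Term A}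
    {K : F.Term (F.Term A)} (hK : Saturated 𝕊 K) (hKD : K.subst id = D.subst τ)
    (hD : IsBasePart 𝕊 m τ D) :
    Graft (fun w E => E = .var (τ w) ∨ E = (τ w).relabel .var) D (K.subst (mark 𝕊 m)) := by
  have hpass := passesToAliens_rankLE (A := A) h𝕊 m
  rcases hD with ⟨w, rfl, hw⟩ | ⟨hrank, hvars⟩
  · refine .var ?_
    change K.subst id = τ w at hKD
    rw [← hKD] at hw ⊢
    cases K with
    | var u => exact (em (RankLE 𝕊 m u)).symm.imp (if_neg ·) (if_pos ·)
    | func f Ks => exact .inr (subst_mark_of_forall (hw.forall_of_saturated_func hpass hK))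
  · rw [subst_mark_of_forall (hpass K hK (hKD ▸ hrank.subst_of_forall_vars hvars)), hKD,
      subst_relabel]
    exact graft_self_subst_iff.2 fun _ _ => .inr rfl

/-- In the second case `τ w` has rank at most `m` and is a part of the base rather than an alien. -/
theorem IsBase.graft_base (h𝕊 : IsShapeSystem 𝕊) {τ : W → F.Term A} {C : F.Term W}
    (h : IsBase 𝕊 m τ C) :
    Graft (fun w E => E = .var (τ w) ∨ E = (τ w).relabel .var) C (h𝕊.base m (C.subst τ)) := by
  obtain ⟨L, hL, hgraft⟩ := h
  have hbelow : Below L (h𝕊.decomp (C.subst τ)) :=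
    below_relabel_iff.1 ((h𝕊.isGreatestTop_decomp _).2.2 L hL
      (hgraft.subst_right fun _ _ _ => trivial))
  have hsat := h𝕊.saturated_decomp (C.subst τ)
  have hsubst := h𝕊.decomp_subst (C.subst τ)
  rw [IsShapeSystem.base]
  generalize h𝕊.decomp (C.subst τ) = K at hbelow hsat hsubst ⊢
  clear hL
  induction hgraft generalizing K with
  | var hD => exact hsat.graft_subst_mark h𝕊 hsubst hD
  | func f _ ih =>
    cases hbelow with
    | func _ hbelow =>
      simp only [Term.subst, Term.func.injEq, heq_eq_eq, true_and] at hsubst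
      exact .func f fun i => ih i _ (hbelow i) (hsat.arg i) (congrFun hsubst i)

end Base

/-! ### Short and tall steps -/

/-- Short steps rewrite the base of a term. -/
def Short (R : TRS F V) {𝕊 : Set (Shape F)} (h𝕊 : IsShapeSystem 𝕊) (m : ℕ) (s t : F.Term A) :
    Prop :=
  RankLE 𝕊 (m + 2) s ∧ ∃ C, Rews R (h𝕊.base m s) C ∧ t = C.subst id

/-- Tall steps rewrite the aliens of rank larger than `m` in parallel. -/
def Tall (R : TRS F V) {𝕊 : Set (Shape F)} (h𝕊 : IsShapeSystem 𝕊) (m : ℕ) (s t : F.Term A) :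
    Prop :=
  RankLE 𝕊 (m + 2) s ∧ Graft (fun u v => RankLE 𝕊 (m + 1) u ∧ Rews R u v) (h𝕊.base m s) t

section ShortTall

variable {R : TRS F V} {𝕊 : Set (Shape F)} {h𝕊 : IsShapeSystem 𝕊} {m : ℕ}

theorem Short.rews {s t : F.Term A} (h : Short R h𝕊 m s t) : Rews R s t := by
  obtain ⟨-, C, hC, rfl⟩ := h
  simpa only [h𝕊.base_subst] using hC.subst id

theorem Tall.rews {s t : F.Term A} (h : Tall R h𝕊 m s t) : Rews R s t := by
  conv_lhs => rw [← h𝕊.base_subst m s]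
  exact (h.2.mono fun _ _ _ => And.right).rews_subst

theorem Tall.refl {s : F.Term A} (hs : RankLE 𝕊 (m + 2) s) : Tall R h𝕊 m s s := by
  have hrank : ∀ u ∈ vars (h𝕊.base m s), RankLE 𝕊 (m + 1) u := fun u hu => by
    obtain ⟨v, hv, hu⟩ := mem_vars_subst.1 hu
    rw [mark] at hu
    split_ifs at hu
    · obtain ⟨x, -, rfl⟩ := mem_vars_relabel.1 hu
      exact rankLE_var h𝕊 _ x
    · obtain rfl := mem_vars_var.1 hu
      exact hs.forall_vars_decomp h𝕊 (passesToAliens_rankLE h𝕊 (m + 1)) _ hv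
  have hgraft : Graft (fun u v => RankLE 𝕊 (m + 1) u ∧ Rews R u v) (h𝕊.base m s)
      ((h𝕊.base m s).subst id) := graft_self_subst_iff.2 fun u hu => ⟨hrank u hu, .refl⟩
  rw [h𝕊.base_subst] at hgraft
  exact ⟨hs, hgraft⟩

theorem short_of_rew_decomp {s : F.Term A} {D : F.Term (F.Term A)} (hs : RankLE 𝕊 (m + 2) s)
    (h : Rew R (h𝕊.decomp s) D) : Short R h𝕊 m s (D.subst id) := by
  refine ⟨hs, _, .single (h.subst (mark 𝕊 m)), ?_⟩
  simp only [subst_subst, mark_subst]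
  rfl

theorem short_of_rew_alien {s t u v : F.Term A} (hs : RankLE 𝕊 (m + 2) s)
    (hu : RankLE 𝕊 m u) (huv : Rew R u v)
    (h : Graft (fun a b => b = a ∨ a = u ∧ b = v) (h𝕊.decomp s) t) : Short R h𝕊 m s t := by
  classical
  obtain ⟨W, E, σ, τ, hE, rfl, hτ⟩ := h.exists_labelled
  let μ : W → F.Term (F.Term A) := fun w => if τ w = σ w then mark 𝕊 m (σ w) else (τ w).relabel .var
  refine ⟨hs, E.subst μ, ?_, ?_⟩
  · rw [IsShapeSystem.base, ← hE, relabel_subst]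
    refine Graft.rews_subst (graft_self_subst_iff.2 fun w _ => ?_)
    by_cases hw : τ w = σ w
    · simp only [μ, if_pos hw]
      exact .refl
    · obtain ⟨hσ, hv⟩ := (hτ w).resolve_left hw
      simp only [μ, if_neg hw]
      rw [hσ, hv, mark, if_pos hu, relabel_eq_subst, relabel_eq_subst]
      exact .single (huv.subst _)
  · rw [subst_subst]
    refine subst_congr fun w _ => ?_
    simp only [μ]
    split_ifs with hw
    · rw [mark_subst, hw]
    · rw [relabel_subst]
      exact (subst_var _).symm

theorem tall_of_rew_alien {s t u v : F.Term A} (hs : RankLE 𝕊 (m + 2) s)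
    (hu : ¬ RankLE 𝕊 m u) (huv : Rew R u v)
    (h : Graft (fun a b => b = a ∨ a = u ∧ b = v) (h𝕊.decomp s) t) : Tall R h𝕊 m s t := by
  refine ⟨hs, graft_subst_iff.2 (h.mono fun a ha b hab => ?_)⟩
  rw [mark]
  split_ifs with hm
  · rcases hab with rfl | ⟨rfl, -⟩
    · exact graft_relabel_iff.2 (graft_self_iff.2 fun x _ => ⟨rankLE_var h𝕊 _ x, .refl⟩)
    · exact absurd hm hu
  · refine .var ⟨hs.forall_vars_decomp h𝕊 (passesToAliens_rankLE h𝕊 (m + 1)) a ha, ?_⟩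
    rcases hab with rfl | ⟨rfl, rfl⟩
    exacts [.refl, .single huv]

theorem Rew.short_or_tall (h𝕊 : IsShapeSystem 𝕊) (hW : WeaklyShapeLayered R 𝕊) {s t : F.Term A}
    (hs : RankLE 𝕊 (m + 2) s) (h : Rew R s t) : Short R h𝕊 m s t ∨ Tall R h𝕊 m s t := by
  rcases h.decomp_cases h𝕊 hW with ⟨D, hD, -, rfl⟩ | ⟨u, -, v, huv, hgraft⟩
  · exact .inl (short_of_rew_decomp hs hD)
  · by_cases hu : RankLE 𝕊 m u
    · exact .inl (short_of_rew_alien hs hu huv hgraft)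
    · exact .inr (tall_of_rew_alien hs hu huv hgraft)

theorem IsBase.short (hR : LeftLinear R) {C D : F.Term W} {τ : W → F.Term A}
    (hC : IsBase 𝕊 m τ C) (h : Rews R C D) : Short R h𝕊 m (C.subst τ) (D.subst τ) := by
  obtain ⟨E, hE, hDE⟩ := (hC.graft_base h𝕊).rews hR h
  refine ⟨hC.rankLE_subst h𝕊, E, hE, (hDE.subst_eq ?_).symm⟩
  rintro w - u (rfl | rfl)
  · rfl
  · rw [relabel_subst]
    exact subst_var _

/-- Rewrite sequences, given by their end points, that start in a term of rank at most `m + 1`. -/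
abbrev TallSeq (R : TRS F V) (𝕊 : Set (Shape F)) (m : ℕ) (A : Type*) :=
  {q : F.Term A × F.Term A // RankLE 𝕊 (m + 1) q.1 ∧ Rews R q.1 q.2}

theorem exists_rews_tallSeq (h𝕊 : IsShapeSystem 𝕊) {C : F.Term W} {τ τ' : W → F.Term A}
    (hτ : ∀ w, RankLE 𝕊 (m + 1) (τ w) ∧ Rews R (τ w) (τ' w)) {B : F.Term (F.Term A)}
    (hB : Graft (fun w E => E = .var (τ w) ∨ E = (τ w).relabel .var) C B) :
    ∃ E E' : F.Term (TallSeq R 𝕊 m A), E.relabel (fun q => q.1.1) = B ∧ Rews R E E' ∧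
      E'.subst (fun q => q.1.2) = C.subst τ' := by
  induction hB with
  | @var w _ h =>
    rcases h with rfl | rfl
    · exact ⟨.var ⟨(τ w, τ' w), hτ w⟩, _, rfl, .refl, rfl⟩
    · let diag : A → TallSeq R 𝕊 m A := fun x => ⟨(.var x, .var x), rankLE_var h𝕊 _ x, .refl⟩
      refine ⟨(τ w).relabel diag, (τ' w).relabel diag, Term.relabel_relabel _ _ _, ?_, ?_⟩
      · simpa only [relabel_eq_subst] using (hτ w).2.subst fun x => .var (diag x)
      · rw [relabel_subst]
        exact subst_var _
  | func f _ ih =>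
    choose Es Es' hEs hstep hEs' using ih
    exact ⟨.func f Es, .func f Es', congrArg (Term.func f) (funext hEs),
      reflTransGen_func Rew.arg f hstep, congrArg (Term.func f) (funext hEs')⟩

theorem IsBase.tall_short (hW : WeaklyShapeLayered R 𝕊) (hR : LeftLinear R) {C : F.Term W}
    {τ τ' : W → F.Term A} (hC : IsBase 𝕊 m τ C)
    (hτ : ∀ w, RankLE 𝕊 (m + 1) (τ w) ∧ Rews R (τ w) (τ' w)) :
    ∃ t, Tall R h𝕊 m (C.subst τ) t ∧ Short R h𝕊 m t (C.subst τ') := by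
  have hrank := hC.rankLE_subst h𝕊
  obtain ⟨E, E', hE, hEE', hE'⟩ := exists_rews_tallSeq h𝕊 hτ (hC.graft_base h𝕊)
  have hbase : IsBase 𝕊 m (fun q => q.1.1) E :=
    IsBase.of_relabel (τ := id) (hE ▸ isBase_base h𝕊 hrank)
  refine ⟨E.subst fun q => q.1.2, ⟨hrank, ?_⟩, ?_⟩
  · rw [← hE]
    exact graft_relabel_iff.2 (graft_self_subst_iff.2 fun q _ => q.2)
  · rw [← hE']
    exact (hbase.of_rews h𝕊 hW fun q => q.2.2).short hR hEE'

theorem Short.join (hW : WeaklyShapeLayered R 𝕊) (hR : LeftLinear R)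
    (hconf : ConfluentUpTo R 𝕊 (m + 1) (F.Term A)) {s t t' : F.Term A} (h : Short R h𝕊 m s t)
    (h' : Short R h𝕊 m s t') : ∃ d, Short R h𝕊 m t d ∧ Short R h𝕊 m t' d := by
  obtain ⟨hs, C, hC, rfl⟩ := h
  obtain ⟨-, C', hC', rfl⟩ := h'
  have hbase := isBase_base h𝕊 hs
  obtain ⟨D, hD, hD'⟩ := hconf _ _ _ (hbase.rankLE h𝕊) hC hC'
  exact ⟨D.subst id, (hbase.rews h𝕊 hW hC).short hR hD, (hbase.rews h𝕊 hW hC').short hR hD'⟩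

theorem Tall.join_short (hW : WeaklyShapeLayered R 𝕊) (hR : LeftLinear R) {s t t' : F.Term A}
    (h : Tall R h𝕊 m s t) (h' : Short R h𝕊 m s t') :
    ∃ d e, Short R h𝕊 m t d ∧ Tall R h𝕊 m t' e ∧ Short R h𝕊 m e d := by
  obtain ⟨hs, hgraft⟩ := h
  obtain ⟨-, D, hD, rfl⟩ := h'
  obtain ⟨W, E, σ, τ, hE, rfl, hστ⟩ := hgraft.exists_labelled
  have hbase : IsBase 𝕊 m σ E := IsBase.of_relabel (τ := id) (hE ▸ isBase_base h𝕊 hs)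
  obtain ⟨E', hEE', rfl⟩ := Rews.of_relabel hR (hE ▸ hD)
  obtain ⟨e, hte, hed⟩ := (hbase.rews h𝕊 hW hEE').tall_short (h𝕊 := h𝕊) hW hR hστ
  exact ⟨_, e, (hbase.of_rews h𝕊 hW fun w => (hστ w).2).short hR hEE',
    by rwa [relabel_subst], hed⟩

theorem Tall.join (hW : WeaklyShapeLayered R 𝕊) (hR : LeftLinear R)
    (hconf : ConfluentUpTo R 𝕊 (m + 1) A) {s t t' : F.Term A} (h : Tall R h𝕊 m s t)
    (h' : Tall R h𝕊 m s t') :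
    ∃ d e e', Tall R h𝕊 m t e ∧ Short R h𝕊 m e d ∧ Tall R h𝕊 m t' e' ∧ Short R h𝕊 m e' d := by
  obtain ⟨hs, hgraft⟩ := h
  obtain ⟨W, E₀, σ₀, τ₀, hE₀, rfl, hστ₀⟩ := hgraft.exists_labelled
  obtain ⟨W', E, π, τ', rfl, rfl, hπ⟩ :=
    (graft_relabel_iff.1 (hE₀.symm ▸ h'.2)).exists_labelled
  rw [Term.relabel_relabel] at hE₀
  have hbase : IsBase 𝕊 m (σ₀ ∘ π) E :=
    IsBase.of_relabel (τ := id) (hE₀ ▸ isBase_base h𝕊 hs)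
  choose δ hδ hδ' using fun w => hconf _ _ _ (hπ w).1 (hστ₀ (π w)).2 (hπ w).2
  rw [relabel_subst]
  have htall : ∀ ω : W' → F.Term A, (∀ w, Rews R (σ₀ (π w)) (ω w)) → (∀ w, Rews R (ω w) (δ w)) →
      ∃ e, Tall R h𝕊 m (E.subst ω) e ∧ Short R h𝕊 m e (E.subst δ) := fun ω hω hωδ =>
    (hbase.of_rews h𝕊 hW hω).tall_short hW hR fun w => ⟨(hπ w).1.rews h𝕊 hW (hω w), hωδ w⟩
  obtain ⟨e, hte, hed⟩ := htall _ (fun w => (hστ₀ (π w)).2) hδ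
  obtain ⟨e', hte', hed'⟩ := htall τ' (fun w => (hπ w).2) hδ'
  exact ⟨_, e, e', hte, hed, hte', hed'⟩

end ShortTall

/-! ### Confluence by induction on the rank -/

section Diagrams

variable {α : Type*} {r q S T : α → α → Prop}

theorem confluent_of_diamond (h : ∀ a b c, r a b → r a c → ∃ d, r b d ∧ r c d) : Confluent r :=
  fun _ _ _ hab hac => church_rosser (fun a b c hab hac =>
    let ⟨d, hbd, hcd⟩ := h a b c hab hac
    ⟨d, .single hbd, .single hcd⟩) hab hac

theorem Confluent.of_le_reflTransGen (h : Confluent q) (hrq : r ≤ ReflTransGen q)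
    (hqr : q ≤ ReflTransGen r) : Confluent r := fun a b c hab hac =>
  let ⟨d, hbd, hcd⟩ := h a b c (reflTransGen_closed hrq _ _ hab) (reflTransGen_closed hrq _ _ hac)
  ⟨d, reflTransGen_closed hqr _ _ hbd, reflTransGen_closed hqr _ _ hcd⟩

theorem exists_join_reflTransGen (hS : Confluent S)
    (hTS : ∀ a b c, T a b → S a c → ∃ d e, S b d ∧ T c e ∧ S e d) {a b c : α} (hab : T a b)
    (hac : ReflTransGen S a c) :
    ∃ d e, ReflTransGen S b d ∧ T c e ∧ ReflTransGen S e d := by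
  induction hac with
  | refl => exact ⟨b, b, .refl, hab, .refl⟩
  | tail _ hcc' ih =>
    obtain ⟨d, e, hbd, hce, hed⟩ := ih
    obtain ⟨d', e', hed', hc'e', he'd'⟩ := hTS _ _ _ hce hcc'
    obtain ⟨g, hdg, hd'g⟩ := hS _ _ _ hed (.single hed')
    exact ⟨g, e', hbd.trans hdg, hc'e', .head he'd' hd'g⟩

theorem confluent_comp_reflTransGen (hS : Confluent S)
    (hTS : ∀ a b c, T a b → S a c → ∃ d e, S b d ∧ T c e ∧ S e d)
    (hT : ∀ a b c, T a b → T a c → ∃ d e e', T b e ∧ S e d ∧ T c e' ∧ S e' d) :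
    Confluent (Comp T (ReflTransGen S)) := by
  refine confluent_of_diamond ?_
  rintro a b c ⟨b₀, hab₀, hb₀b⟩ ⟨c₀, hac₀, hc₀c⟩
  obtain ⟨d, e, e', hb₀e, hed, hc₀e', he'd⟩ := hT _ _ _ hab₀ hac₀
  obtain ⟨x, y, hex, hby, hyx⟩ := exists_join_reflTransGen hS hTS hb₀e hb₀b
  obtain ⟨x', y', he'x', hcy', hy'x'⟩ := exists_join_reflTransGen hS hTS hc₀e' hc₀c
  obtain ⟨z, hxz, hdz⟩ := hS _ _ _ hex (.single hed)
  obtain ⟨z', hx'z', hdz'⟩ := hS _ _ _ he'x' (.single he'd)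
  obtain ⟨t, hzt, hz't⟩ := hS _ _ _ hdz hdz'
  exact ⟨t, ⟨y, hby, hyx.trans (hxz.trans hzt)⟩, ⟨y', hcy', hy'x'.trans (hx'z'.trans hz't)⟩⟩

theorem confluent_sup_of_diagrams (hrefl : ∀ a b, S a b → T a a)
    (hS : ∀ a b c, S a b → S a c → ∃ d, S b d ∧ S c d)
    (hTS : ∀ a b c, T a b → S a c → ∃ d e, S b d ∧ T c e ∧ S e d)
    (hT : ∀ a b c, T a b → T a c → ∃ d e e', T b e ∧ S e d ∧ T c e' ∧ S e' d) :
    Confluent (S ⊔ T) := by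
  refine (confluent_comp_reflTransGen (confluent_of_diamond hS) hTS hT).of_le_reflTransGen ?_ ?_
  · rintro a b (h | h)
    exacts [.single ⟨a, hrefl a b h, .single h⟩, .single ⟨b, h, .refl⟩]
  · rintro a b ⟨c, hac, hcb⟩
    exact .head (.inr hac) (ReflTransGen.mono le_sup_left _ _ hcb)

end Diagrams

section Rank

variable {R : TRS F V} {𝕊 : Set (Shape F)}

theorem ConfluentUpTo.succ [Infinite A] (h𝕊 : IsShapeSystem 𝕊) (hW : WeaklyShapeLayered R 𝕊)
    (hR : LeftLinear R) {m : ℕ} (hconf : ConfluentUpTo R 𝕊 (m + 1) A) :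
    ConfluentUpTo R 𝕊 (m + 2) A := by
  have : Nonempty (F.Term A) := ⟨.var (Classical.arbitrary A)⟩
  have hdiag : Confluent (Short R h𝕊 m ⊔ Tall R h𝕊 m : F.Term A → F.Term A → Prop) :=
    confluent_sup_of_diagrams (fun _ _ h => Tall.refl h.1)
      (fun _ _ _ h h' => h.join hW hR hconf.transfer h') (fun _ _ _ h h' => h.join_short hW hR h')
      (fun _ _ _ h h' => h.join hW hR hconf h')
  have hof : ReflTransGen (Short R h𝕊 m ⊔ Tall R h𝕊 m : F.Term A → F.Term A → Prop) ≤ Rews R :=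
    reflTransGen_closed fun _ _ h => h.elim Short.rews Tall.rews
  have hto : ∀ {s t : F.Term A}, RankLE 𝕊 (m + 2) s → Rews R s t →
      ReflTransGen (Short R h𝕊 m ⊔ Tall R h𝕊 m) s t := fun hs h => by
    induction h with
    | refl => exact .refl
    | tail hst h ih => exact ih.tail (h.short_or_tall h𝕊 hW (hs.rews h𝕊 hW hst))
  intro s t₁ t₂ hs h₁ h₂
  obtain ⟨t, ht₁, ht₂⟩ := hdiag _ _ _ (hto hs h₁) (hto hs h₂)
  exact ⟨t, hof _ _ ht₁, hof _ _ ht₂⟩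

theorem confluent_rew [Infinite A] (h𝕊 : IsShapeSystem 𝕊) (hW : WeaklyShapeLayered R 𝕊)
    (hR : LeftLinear R) (hconf : ConfluentUpTo R 𝕊 1 A) :
    Confluent (Rew R : F.Term A → F.Term A → Prop) := by
  have hall : ∀ n, ConfluentUpTo R 𝕊 (n + 1) A := fun n => by
    induction n with
    | zero => exact hconf
    | succ n ih => exact ih.succ h𝕊 hW hR
  intro s t₁ t₂ h₁ h₂
  obtain ⟨n, hn⟩ := exists_rankLE h𝕊 s
  exact hall n s t₁ t₂ (hn.succ h𝕊) h₁ h₂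

end Rank

/-! ### From contexts to shapes -/

section Ctx

theorem ctxLE_iff_graft {C D : Ctx F V} :
    CtxLE C D ↔ Graft (fun a u => a = none ∨ u = .var a) C D := by
  constructor <;> intro h
  · induction h with
    | hole C => exact .var (.inl rfl)
    | var x => exact .var (.inr rfl)
    | func f _ _ _ ih => exact .func f ih
  · induction h with
    | var h =>
      rcases h with rfl | rfl
      exacts [.hole _, .refl _]
    | func f _ ih => exact .func f _ _ ih

theorem CtxLE.below_shape {C : Ctx F V} {t : F.Term A} {g : A → Option V}
    (h : CtxLE C (t.relabel g)) : Below (shape C) t :=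
  below_relabel_iff.1 (ctxLE_iff_graft.1 h).below_shape

theorem relabel_none_ctxLE_iff {D : Shape F} {C : Ctx F V} :
    CtxLE (D.relabel fun _ => none) C ↔ Below D C := by
  simp only [ctxLE_iff_graft, graft_relabel_iff, true_or, Below]

theorem CtxLE.antisymm {C D : Ctx F V} (h : CtxLE C D) (h' : CtxLE D C) : C = D := by
  rw [ctxLE_iff_graft] at h h'
  induction h with
  | var h =>
    rcases h with rfl | rfl
    · cases h' with | var h' => rcases h' with rfl | h'; exacts [rfl, h']
    · rfl
  | func f _ ih => exact congrArg _ (funext fun i => ih i (graft_func_func_iff.1 h' i))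

theorem eq_toCtx_of_ctxLE {M : Ctx F V} {x : V} (h : CtxLE M (toCtx (.var x))) (hne : M ≠ hole) :
    M = toCtx (.var x) := by
  cases h with
  | hole _ => exact absurd rfl hne
  | var _ => rfl

theorem exists_greatest_ctxLE {D : Shape F} {t : F.Term V} (h : Below D t) :
    ∃ M : Ctx F V, shape M = D ∧ CtxLE M (toCtx t) ∧
      ∀ N, CtxLE N (toCtx t) → Below (shape N) D → CtxLE N M := by
  simp only [ctxLE_iff_graft]
  induction h with
  | @var a t _ =>
    cases t with
    | var x => exact ⟨toCtx (.var x), rfl, .var (.inr rfl), fun N hN _ => hN⟩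
    | func f ts =>
      refine ⟨hole, rfl, .var (.inl rfl), fun N hN hND => ?_⟩
      rcases N with b | ⟨g, Ns⟩
      · cases hN with | var h => exact .var (.inl (h.resolve_right nofun))
      · cases hND
  | func f _ ih =>
    choose M hM hMt hmax using ih
    refine ⟨.func f M, congrArg _ (funext hM), .func f hMt, fun N hN hND => ?_⟩
    rcases N with b | ⟨g, Ns⟩
    · cases hN with | var h => exact .var (.inl (h.resolve_right nofun))
    · cases hN with
      | func _ h => exact .func f fun i => hmax i _ (h i) (graft_func_func_iff.1 hND i)

/-- `D` arises from `C` by replacing one occurrence of a variable by the hole. -/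
def ErasesVar (C D : Ctx F V) : Prop :=
  ∃ x p, subtermAt C p = some (.var (some x)) ∧ D = replaceAt C p hole

theorem ErasesVar.arg {n : ℕ} (f : F.Functions n) (Cs : Fin n → Ctx F V) (i : Fin n) (D : Ctx F V)
    (h : ErasesVar (Cs i) D) : ErasesVar (.func f Cs) (.func f (Function.update Cs i D)) := by
  obtain ⟨x, p, hp, rfl⟩ := h
  exact ⟨x, i :: p, by rwa [subtermAt_func], by rw [replaceAt_func]⟩

theorem reflTransGen_erasesVar (C : Ctx F V) :
    ReflTransGen ErasesVar C (C.relabel fun _ => none) := by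
  induction C with
  | var a =>
    cases a with
    | none => exact .refl
    | some x => exact .single ⟨x, [], by simp only [subtermAt], by simp only [replaceAt]; rfl⟩
  | func f _ ih => exact reflTransGen_func ErasesVar.arg f ih

end Ctx

/-- The shapes of the elements of `𝕃`, for a set `𝕃` of contexts with (L2). -/
def shapes (𝕃 : Set (Ctx F V)) : Set (Shape F) := {D | (D.relabel fun _ => none) ∈ 𝕃}

section LayerSystem

variable {𝕃 : Set (Ctx F V)} {R : TRS F V}

theorem IsLayerSystem.mem_iff_of_erasesVar (h𝕃 : IsLayerSystem 𝕃) {C D : Ctx F V}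
    (h : ErasesVar C D) : D ∈ 𝕃 ↔ C ∈ 𝕃 := by
  obtain ⟨x, p, hp, rfl⟩ := h
  have hC : p ∈ positions C := Option.isSome_iff_exists.2 ⟨_, hp⟩
  rw [← h𝕃.L2 x C p hC, replaceAt_self hp]

theorem IsLayerSystem.shape_mem_shapes_iff (h𝕃 : IsLayerSystem 𝕃) {C : Ctx F V} :
    shape C ∈ shapes 𝕃 ↔ C ∈ 𝕃 := by
  suffices h : ∀ D, ReflTransGen ErasesVar C D → (D ∈ 𝕃 ↔ C ∈ 𝕃) by
    rw [shapes, Set.mem_ofPred_eq, Term.relabel_relabel]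
    exact h _ (reflTransGen_erasesVar C)
  intro D h
  induction h with
  | refl => rfl
  | tail _ h ih => exact (h𝕃.mem_iff_of_erasesVar h).trans ih

theorem IsLayerSystem.exists_isMaxTop (h𝕃 : IsLayerSystem 𝕃) {D : Shape F} {t : F.Term V}
    (h : IsGreatestTop (shapes 𝕃) D t) : ∃ M : Ctx F V, shape M = D ∧ IsMaxTop 𝕃 M (toCtx t) := by
  obtain ⟨hD, hDt, hmax⟩ := h
  obtain ⟨M, rfl, hMt, hM⟩ := exists_greatest_ctxLE hDt
  refine ⟨M, rfl, ⟨h𝕃.shape_mem_shapes_iff.1 hD, hMt⟩, fun N hN hMN => hMN.antisymm ?_⟩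
  exact hM N hN.2 (hmax _ (h𝕃.shape_mem_shapes_iff.2 hN.1) hN.2.below_shape)

theorem isMerge_relabel_none {D N E : Shape F} (h : IsShapeSup D N E) :
    IsMerge (V := V) (D.relabel fun _ => none) (N.relabel fun _ => none)
      (E.relabel fun _ => none) := by
  refine ⟨relabel_none_ctxLE_iff.2 (below_relabel_iff.2 h.1),
    relabel_none_ctxLE_iff.2 (below_relabel_iff.2 h.2.1), fun C hDC hNC => ?_⟩
  rw [relabel_none_ctxLE_iff] at hDC hNC ⊢
  exact below_relabel_iff.1
    (h.2.2 (shape C) (below_relabel_iff.2 hDC) (below_relabel_iff.2 hNC))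

theorem IsLayerSystem.isShapeSystem [Nonempty V] (h𝕃 : IsLayerSystem 𝕃) :
    IsShapeSystem (shapes 𝕃) where
  hole_mem := by
    obtain ⟨x⟩ := ‹Nonempty V›
    obtain ⟨M, ⟨hM, hMx⟩, hne⟩ := h𝕃.L1 (.var x)
    exact h𝕃.shape_mem_shapes_iff.2 (eq_toCtx_of_ctxLE hMx hne ▸ hM)
  exists_func f ts := by
    obtain ⟨x⟩ := ‹Nonempty V›
    obtain ⟨M, ⟨hM, hMt⟩, hne⟩ := h𝕃.L1 ((Term.func f ts).relabel fun _ => x)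
    have hbelow : Below (shape M) (.func f ts) := below_relabel_iff.1 hMt.below_shape
    cases hMt with
    | hole _ => exact absurd rfl hne
    | func _ Ms _ _ => exact ⟨_, h𝕃.shape_mem_shapes_iff.2 hM, graft_func_func_iff.1 hbelow⟩
  merge L hL N hN p hp D E hD hE := by
    have hmem := h𝕃.L3 _ hL _ hN p ((mem_funPositions_relabel _).2 hp) _ _
      (by rw [subtermAt_relabel, hD]; rfl) (isMerge_relabel_none hE)
    simpa only [shapes, Set.mem_ofPred_eq, relabel_eq_subst, replaceAt_subst hD] using hmem

theorem IsLayerSystem.weaklyShapeLayered [Nonempty V] (h𝕃 : IsLayerSystem 𝕃)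
    (hW : WeaklyLayered R 𝕃) : WeaklyShapeLayered R (shapes 𝕃) := by
  intro ρ hρ s t D p hD hp hst
  obtain ⟨x⟩ := ‹Nonempty V›
  obtain ⟨M, rfl, hM⟩ := h𝕃.exists_isMaxTop ((isGreatestTop_relabel_iff (g := fun _ => x)).2 hD)
  obtain ⟨L, hL, hML⟩ := hW ρ hρ _ (t.relabel fun _ => x) M p hM
    ((mem_funPositions_relabel _).1 hp) (by simpa only [relabel_eq_subst] using hst.subst _)
  exact ⟨shape L, h𝕃.shape_mem_shapes_iff.2 hL,
    by simpa only [shape, relabel_eq_subst] using hML.subst _⟩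

theorem aliens_toCtx (t : F.Term V) : aliens (toCtx t) t = [] := by
  induction t with
  | var x => simp [toCtx, aliens]
  | func f ts ih =>
    simp only [toCtx, Term.relabel, aliens, List.flatten_eq_nil_iff, List.mem_ofFn]
    rintro _ ⟨i, rfl⟩
    rw [dif_pos i.isLt]
    exact ih i

theorem toCtx_ne_hole (t : F.Term V) : toCtx t ≠ hole := by
  cases t <;> simp [toCtx, hole]

theorem rank_eq_one_of_toCtx_mem {t : F.Term V} (h : toCtx t ∈ 𝕃) : rank 𝕃 t = 1 := by
  have htop : IsTop 𝕃 (toCtx t) (toCtx t) := ⟨h, .refl _⟩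
  have hex : ∃ M, IsMaxTop 𝕃 M (toCtx t) ∧ M ≠ hole :=
    ⟨toCtx t, ⟨htop, fun N hN htN => htN.antisymm hN.2⟩, toCtx_ne_hole t⟩
  have hchoose : hex.choose = toCtx t :=
    hex.choose_spec.1.2 _ htop hex.choose_spec.1.1.2
  have haliens : (aliens hex.choose t).attach = [] := by
    rw [List.attach_eq_nil_iff, hchoose, aliens_toCtx]
  rw [rank, dif_pos hex, haliens]
  rfl

theorem shape_mem_of_rankLE_one {𝕊 : Set (Shape F)} {t : F.Term A} (h : RankLE 𝕊 1 t) :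
    shape t ∈ 𝕊 := by
  obtain ⟨L, hL, hgraft⟩ := h
  suffices hshape : L = shape t from hshape ▸ hL
  clear hL
  induction hgraft with
  | var h => obtain ⟨x, rfl⟩ := h; rfl
  | func f _ ih => exact congrArg _ (funext ih)

theorem IsLayerSystem.rank_eq_one (h𝕃 : IsLayerSystem 𝕃) {t : F.Term V}
    (h : RankLE (shapes 𝕃) 1 t) : rank 𝕃 t = 1 :=
  rank_eq_one_of_toCtx_mem <| h𝕃.shape_mem_shapes_iff.1 <| by
    simpa only [toCtx, shape, Term.relabel_relabel] using shape_mem_of_rankLE_one h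

theorem ConfluentOn.exists_join {α : Type*} {r : α → α → Prop} {S : Set α} (h : ConfluentOn r S)
    {a b c : α} (ha : a ∈ S) (hab : ReflTransGen r a b) (hac : ReflTransGen r a c) :
    ∃ d, ReflTransGen r b d ∧ ReflTransGen r c d := by
  let restr : α → α → Prop := fun a b => r a b ∧ a ∈ S ∧ b ∈ S
  have hrestrict : ∀ b, ReflTransGen r a b → b ∈ S ∧ ReflTransGen restr a b := fun b hab => by
    induction hab with
    | refl => exact ⟨ha, .refl⟩
    | tail _ hbc ih =>
      have hc := h.1 _ ih.1 _ hbc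
      exact ⟨hc, ih.2.tail ⟨hbc, ih.1, hc⟩⟩
  obtain ⟨d, hbd, hcd⟩ := h.2 a b c (hrestrict b hab).2 (hrestrict c hac).2
  exact ⟨d, ReflTransGen.mono (fun _ _ => And.left) _ _ hbd,
    ReflTransGen.mono (fun _ _ => And.left) _ _ hcd⟩

end LayerSystem

end Rewriting

theorem mainTheorem2_general {F : FirstOrder.Language.{u, v}} {V : Type w} [Infinite V]
    (𝕃 : Set (Rewriting.Ctx F V)) (h𝕃 : Rewriting.IsLayerSystem 𝕃)
    (R : Rewriting.TRS F V) (hW : Rewriting.WeaklyLayered R 𝕃)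
    (hconf : Rewriting.ConfluentOn (Rewriting.Step R) {t : F.Term V | Rewriting.rank 𝕃 t = 1})
    (hlin : Rewriting.LeftLinear R) :
    Rewriting.Confluent (Rewriting.Step R) :=
  Rewriting.confluent_rew h𝕃.isShapeSystem (h𝕃.weaklyShapeLayered hW) hlin
    fun _ _ _ hs => hconf.exists_join (h𝕃.rank_eq_one hs)

theorem mainTheorem2 {F : FirstOrder.Language.{u, v}} {V : Type w} [Countable V] [Infinite V]
    (𝕃 : Set (Rewriting.Ctx F V)) (h𝕃 : Rewriting.IsLayerSystem 𝕃)
    (R : Rewriting.TRS F V) (hW : Rewriting.WeaklyLayered R 𝕃)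
    (hconf : Rewriting.ConfluentOn (Rewriting.Step R) {t : F.Term V | Rewriting.rank 𝕃 t = 1})
    (hlin : Rewriting.LeftLinear R) :
    Rewriting.Confluent (Rewriting.Step R) :=
  mainTheorem2_general 𝕃 h𝕃 R hW hconf hlin
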